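/- Let $w$ be a positive continuous function on $(0,\infty)$, and let $(a_k)_{k\ge1}$ be a sequence of positive numbers for which there is a $d>0$ with $a_{k+1}-a_k>d$ for all $k$. Put $m(r)=\frac1{a_1}$ for $0\le r\le a_1$, $m(r)=\sum_{a_k<r}\frac1{a_k}$ for $r>a_1$, and $\Psi(r)=e^{2m(r)}$. Let $S=\mathrm{span}\{t^{a_k}:k=1,2,\dots\}$. For $1\le p<\infty$ let $L^p_w(0,\infty)=\{f:\|fw\|_{L^p(0,\infty)}<\infty\}$ with the norm $\|fw\|_{L^p(0,\infty)}$, and let $C_{w,(0,\infty)}=\{f\in C(0,\infty):\lim_{t\to0+}f(t)w(t)=\lim_{t\to\infty}f(t)w(t)=0\}$ with the norm $\sup_{t>0}|f(t)w(t)|$ (real or complex scalars). For $x>0$ put $$\varphi_p(x)=\left(\int_0^\infty t^{px}w^p(t)\,dt\right)^{\frac1{px}},\qquad \varphi_c(x)=\left(\sup_{t>0}t^xw(t)\right)^{\frac1x}.$$ For a function $\varphi:(0,\infty)\to(0,\infty)$ consider the condition $(\ast)_\varphi$: there is a monotone increasing function $h$ on $(0,\infty)$ such that (i) there are $C_1,D_1>0$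 with $C_1<\frac{h(r)}{h(r_1)}<D_1$ for all $r,r_1>0$ with $\frac12\le\frac r{r_1}\le2$; (ii) $\int_1^\infty\frac{h(r)}{r^2}\,dr=\infty$; (iii) there are $\alpha,C,c>0$ such that $0<h(r)\le C^{1/x}\,\frac{cx}{\varphi(x)^{\alpha}}\,\Psi(r)^{\alpha}$ for all $0<x\le r$. Then: (a) If $1\le p<\infty$, $t^xw(t)\in L^p(0,\infty)$ for all $x>0$, and $(\ast)_{\varphi_p}$ holds, then $S$ is complete in $L^p_w(0,\infty)$, that is, $S$ is a dense subspace of $L^p_w(0,\infty)$. (b) If $\lim_{t\to0+}t^xw(t)=\lim_{t\to\infty}t^xw(t)=0$ for all $x>0$, and $(\ast)_{\varphi_c}$ holds, then $S$ is complete in $C_{w,(0,\infty)}$, that is, $S$ is a dense subspace of $C_{w,(0,\infty)}$. -/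

import Mathlib

open Set Filter Topology MeasureTheory
open scoped ENNReal

noncomputable section

namespace Muntz

/-- The counting sum `m(r)` of the exponents `a 0 < a 1 < ...`: it is `1 / a 0` for `r ≤ a 0`, and
the sum of `1 / a k` over all `k` with `a k < r` for `r > a 0`. The sum is finite for every `r`
when the exponents are separated. -/
def m (a : ℕ → ℝ) (r : ℝ) : ℝ :=
  if r ≤ a 0 then 1 / a 0 else ∑' k, if a k < r then 1 / a k else 0

/-- `Ψ(r) = exp (2 m(r))`. -/
def Psi (a : ℕ → ℝ) (r : ℝ) : ℝ := Real.exp (2 * m a r)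

/-- `φ_p(x) = (∫₀^∞ t^{px} w(t)^p dt)^{1/(px)}`. -/
def phiLp (w : ℝ → ℝ) (p x : ℝ) : ℝ :=
  (∫ t in Ioi (0 : ℝ), t ^ (p * x) * w t ^ p) ^ (1 / (p * x))

/-- `φ_c(x) = (sup_{t>0} t^x w(t))^{1/x}`. -/
def phiC (w : ℝ → ℝ) (x : ℝ) : ℝ :=
  (⨆ t : Ioi (0 : ℝ), (t : ℝ) ^ x * w t) ^ (1 / x)

/-- The linear span `S` of the functions `t ↦ t^{a k}`. Only the values on `(0,∞)` matter below. -/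
def muntzSpan (𝕜 : Type*) [RCLike 𝕜] (a : ℕ → ℝ) : Submodule 𝕜 (ℝ → 𝕜) :=
  Submodule.span 𝕜 (range fun (k : ℕ) (t : ℝ) => ((t ^ a k : ℝ) : 𝕜))

/-- The weighted norm `‖f w‖_{L^p(0,∞)}`. -/
def normLpW {𝕜 : Type*} [RCLike 𝕜] (w : ℝ → ℝ) (p : ℝ) (f : ℝ → 𝕜) : ℝ≥0∞ :=
  eLpNorm (fun t => f t * (w t : 𝕜)) (ENNReal.ofReal p) (volume.restrict (Ioi 0))

/-- The space `L^p_w(0,∞)`: the functions `f` with `f w ∈ L^p(0,∞)`. -/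
def LpW (𝕜 : Type*) [RCLike 𝕜] (w : ℝ → ℝ) (p : ℝ) : Set (ℝ → 𝕜) :=
  {f | MemLp (fun t => f t * (w t : 𝕜)) (ENNReal.ofReal p) (volume.restrict (Ioi 0))}

/-- The weighted uniform norm `sup_{t>0} |f(t) w(t)|`. -/
def normCW {𝕜 : Type*} [RCLike 𝕜] (w : ℝ → ℝ) (f : ℝ → 𝕜) : ℝ≥0∞ :=
  ⨆ t : Ioi (0 : ℝ), ‖f t * (w t : 𝕜)‖ₑ

/-- The space `C_{w,(0,∞)}`: the functions `f`, continuous on `(0,∞)`, such that `f(t) w(t)` tends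
to `0` as `t → 0+` and as `t → ∞`. -/
def CW (𝕜 : Type*) [RCLike 𝕜] (w : ℝ → ℝ) : Set (ℝ → 𝕜) :=
  {f | ContinuousOn f (Ioi 0) ∧
    Tendsto (fun t => f t * (w t : 𝕜)) (𝓝[>] 0) (𝓝 0) ∧
    Tendsto (fun t => f t * (w t : 𝕜)) atTop (𝓝 0)}

/-- `S` is complete in `L^p_w(0,∞)`: it is contained in this space and dense in it. -/
def CompleteInLpW (𝕜 : Type*) [RCLike 𝕜] (w : ℝ → ℝ) (p : ℝ) (a : ℕ → ℝ) : Prop :=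
  (muntzSpan 𝕜 a : Set (ℝ → 𝕜)) ⊆ LpW 𝕜 w p ∧
    ∀ f ∈ LpW 𝕜 w p, ∀ ε : ℝ, 0 < ε →
      ∃ g ∈ muntzSpan 𝕜 a, normLpW w p (f - g) < ENNReal.ofReal ε

/-- `S` is complete in `C_{w,(0,∞)}`: it is contained in this space and dense in it. -/
def CompleteInCW (𝕜 : Type*) [RCLike 𝕜] (w : ℝ → ℝ) (a : ℕ → ℝ) : Prop :=
  (muntzSpan 𝕜 a : Set (ℝ → 𝕜)) ⊆ CW 𝕜 w ∧
    ∀ f ∈ CW 𝕜 w, ∀ ε : ℝ, 0 < ε →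
      ∃ g ∈ muntzSpan 𝕜 a, normCW w (f - g) < ENNReal.ofReal ε

/-- The conditions on the function `h`: it is increasing on `(0,∞)`, it satisfies the two-sided
doubling condition, the integral of `h(r)/r²` over `(1,∞)` diverges, and
`0 < h(r) ≤ C^{1/x} c x Ψ(r)^α / φ(x)^α` for all `0 < x ≤ r`, with some `α, C, c > 0`. -/
def IsDivergentMinorant (φ : ℝ → ℝ) (a : ℕ → ℝ) (h : ℝ → ℝ) : Prop :=
  MonotoneOn h (Ioi 0) ∧
  (∃ C D : ℝ, 0 < C ∧ 0 < D ∧ ∀ r r₁ : ℝ, 0 < r → 0 < r₁ → 1 / 2 ≤ r / r₁ → r / r₁ ≤ 2 →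
    C < h r / h r₁ ∧ h r / h r₁ < D) ∧
  (∫⁻ r in Ioi (1 : ℝ), ENNReal.ofReal (h r / r ^ 2) = ⊤) ∧
  ∃ α C c : ℝ, 0 < α ∧ 0 < C ∧ 0 < c ∧ ∀ x r : ℝ, 0 < x → x ≤ r →
    0 < h r ∧ h r ≤ C ^ (1 / x) * (c * x / φ x ^ α) * Psi a r ^ α

end Muntz

end

/-! Write x = Re z. Multiplication by `w` embeds the functions dominated by positive powers into a
Banach space X (`Lp`, or the bounded continuous functions), where t^z has norm at most φ(x)^x. Let
F(z) be the class of t^z modulo the closed span of the t^{a_k}. F is holomorphic for x > 0, vanishes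
at every a_k, and satisfies ‖F(z)‖ ≤ φ(x)^x. The theorem reduces to F = 0
(`eq_zero_of_isDivergentMinorant`). Working in the quotient replaces the usual annihilating
functional.

Condition (iii) with r = |z| and β = 1/α bounds ‖F(z)‖ by a constant times (c x/h(|z|))^{βx} exp(2x
m(|z|)). Dividing by finitely many modified Blaschke factors removes the last exponential up to
e^{κx}, away from the zeros (`exp_mul_m_le`). The maximum principle covers small discs around the
zeros. The quotient H then satisfies ‖H(z)‖ ≤ A (B x/h(|z|))^{βx} for |z| ≤ 8^N, with A and B
independent of N.

Divergence enters by descending through the radii 8^n. If ‖H‖ ≤ A q^{-βx} for |z| ≤ 8R, the bound on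
H is better by e^{-βx} in a strip of width about h(R)/(Bq) along the imaginary axis. Comparison with
the angle subtended by a segment of that axis carries the gain to |z| ≤ R, where q may be replaced
by q + h(R)/(384πBR) (`norm_le_of_norm_le_eight_mul`). The increments add up to a sum that diverges
with ∫ h(r)/r² dr. Since ‖F(x)‖ ≤ ‖H(x)‖ for 0 < x < a_0, F vanishes on a real interval, hence
everywhere.

Thus all powers t^z lie in the closed span. With t = e^s, Fejér-type approximation by t times
trigonometric polynomials in log t, of long period, reaches all continuous functions with compact
support in (0,∞) (`compactSupport_mem_of_powerElt_mem`). These are dense in both weighted spaces. -/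

namespace Muntz

/-! ### Maximum principles in half-discs. -/

/-- The angle under which the segment from `i s` to `i t` is seen from `z`. -/
noncomputable def segAngle (s t : ℝ) (z : ℂ) : ℝ :=
  Real.arctan ((z.im - s) / z.re) - Real.arctan ((z.im - t) / z.re)

theorem segAngle_le_pi (s t : ℝ) (z : ℂ) : segAngle s t z ≤ Real.pi := by
  unfold segAngle
  have := Real.arctan_lt_pi_div_two ((z.im - s) / z.re)
  have := Real.neg_pi_div_two_lt_arctan ((z.im - t) / z.re)
  linarith

theorem pi_div_two_sub_arctan_le {x d : ℝ} (hx : 0 < x) (hd : 0 < d) :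
    Real.pi / 2 - Real.arctan (d / x) ≤ x / d := by
  rw [← Real.arctan_inv_of_pos (by positivity), inv_div]
  have h0 : 0 ≤ x / d := by positivity
  calc Real.arctan (x / d) ≤ Real.tan (Real.arctan (x / d)) :=
        Real.le_tan (Real.arctan_nonneg.2 h0) (Real.arctan_lt_pi_div_two _)
    _ = x / d := Real.tan_arctan _

/-- At height at least `w` below `s` or above `t`, one arctangent is within x/w of ±π/2 and the
other cannot pass that value. -/
theorem segAngle_le_div {s t w : ℝ} {z : ℂ} (hz : 0 < z.re) (hw : 0 < w)
    (h : z.im ≤ s - w ∨ t + w ≤ z.im) : segAngle s t z ≤ z.re / w := by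
  unfold segAngle
  rcases h with h | h
  · have h1 : Real.arctan ((z.im - s) / z.re) ≤ - Real.arctan (w / z.re) := by
      rw [← Real.arctan_neg, ← neg_div]
      refine Real.arctan_mono ?_
      gcongr
      linarith
    have := Real.neg_pi_div_two_lt_arctan ((z.im - t) / z.re)
    have := pi_div_two_sub_arctan_le hz hw
    linarith
  · have h1 : Real.arctan (w / z.re) ≤ Real.arctan ((z.im - t) / z.re) := by
      refine Real.arctan_mono ?_
      gcongr
      linarith
    have := Real.arctan_lt_pi_div_two ((z.im - s) / z.re)
    have := pi_div_two_sub_arctan_le hz hw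
    linarith

/-- The angle is the integral of the unnormalized Poisson kernel over the segment. The mean value
form yields both the upper and the lower bounds needed later. -/
theorem exists_segAngle_eq {s t : ℝ} (hst : s < t) {z : ℂ} (hz : 0 < z.re) :
    ∃ u ∈ Ioo s t, segAngle s t z = (t - s) * (z.re / (z.re ^ 2 + (z.im - u) ^ 2)) := by
  have hd : ∀ u, HasDerivAt (fun u => - Real.arctan ((z.im - u) / z.re))
      (z.re / (z.re ^ 2 + (z.im - u) ^ 2)) u := by
    intro u
    have h1 : HasDerivAt (fun u => (z.im - u) / z.re) (-1 / z.re) u :=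
      ((hasDerivAt_id u).const_sub z.im).div_const z.re
    refine h1.arctan.fun_neg.congr_deriv ?_
    have : z.re ^ 2 + (z.im - u) ^ 2 ≠ 0 := by positivity
    have : 1 + ((z.im - u) / z.re) ^ 2 ≠ 0 := by positivity
    field_simp
  obtain ⟨u, hu, h⟩ := exists_hasDerivAt_eq_slope _ _ hst
    (fun u _ => (hd u).continuousAt.continuousWithinAt) (fun u _ => hd u)
  refine ⟨u, hu, ?_⟩
  rw [h, segAngle]
  have : t - s ≠ 0 := by linarith
  field_simp
  ring

/-- A function holomorphic in the right half-plane near the segment whose real part is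
`segAngle s t`. -/
noncomputable def segPotential (s t : ℝ) (z : ℂ) : ℂ :=
  Complex.I * (Complex.log (z - t * Complex.I) - Complex.log (z - s * Complex.I))

theorem re_segPotential {s t : ℝ} {z : ℂ} (hz : 0 < z.re) :
    (segPotential s t z).re = segAngle s t z := by
  have key : ∀ u : ℝ, (Complex.log (z - u * Complex.I)).im = Real.arctan ((z.im - u) / z.re) := by
    intro u
    rw [Complex.log_im]
    have h0 : 0 < (z - u * Complex.I).re := by simpa using hz
    rw [Complex.arg_of_re_nonneg h0.le]
    rw [Real.arctan_eq_arcsin]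
    congr 1
    have hn : ‖z - u * Complex.I‖ = z.re * √(1 + ((z.im - u) / z.re) ^ 2) := by
      rw [Complex.norm_eq_sqrt_sq_add_sq, ← Real.sqrt_sq hz.le, ← Real.sqrt_mul (by positivity)]
      rw [Real.sqrt_sq hz.le]
      congr 1
      simp
      field_simp
    rw [hn, div_div]
    simp
  simp only [segPotential, Complex.mul_re, Complex.I_re, Complex.I_im, Complex.sub_im, key,
    segAngle]
  ring

theorem differentiableAt_segPotential (s t : ℝ) {z : ℂ} (hz : 0 < z.re) :
    DifferentiableAt ℂ (segPotential s t) z := by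
  unfold segPotential
  have key : ∀ u : ℝ, DifferentiableAt ℂ (fun z : ℂ => Complex.log (z - u * Complex.I)) z := by
    intro u
    apply DifferentiableAt.clog (by fun_prop)
    left
    simpa using hz
  exact ((key t).sub (key s)).const_mul _

variable {E : Type*} [NormedAddCommGroup E] [NormedSpace ℂ E]

/-- A bounded function in a half-disc that is small in a strip along the imaginary axis is small
in a smaller half-disc. -/
theorem norm_le_of_small_near_boundary {G : ℂ → E} (hG : DifferentiableOn ℂ G {z | 0 < z.re})
    {R w β A : ℝ} (hR : 0 < R) (hw : 0 < w) (hwR : w ≤ R / 2) (hβ : 0 < β)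
    (h1 : ∀ z : ℂ, 0 < z.re → ‖z‖ ≤ 8 * R → ‖G z‖ ≤ A)
    (h2 : ∀ z : ℂ, 0 < z.re → z.re ≤ w → R ≤ ‖z‖ → ‖z‖ ≤ 8 * R →
      ‖G z‖ ≤ A * Real.exp (-(β * z.re)))
    {z : ℂ} (hz : 0 < z.re) (hzR : ‖z‖ ≤ R) :
    ‖G z‖ ≤ A * Real.exp (-(β * w / (24 * Real.pi * R) * z.re)) := by
  have hA : 0 ≤ A := (norm_nonneg _).trans (h1 z hz (by linarith))
  set s := 3 / 2 * R with hs
  set t := 2 * R with ht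
  set τ := β * w / Real.pi with hτ
  have hτ0 : 0 < τ := by positivity
  -- The correction z/(72R) makes the exponent nonpositive on |ζ| = 8R. There the distance to the
  -- segment is at least 6R, so the angle is at most (R/2) x/(6R)² = x/(72R).
  set Φ : ℂ → E := fun z => Complex.exp (τ * (segPotential s t z - z / (72 * R : ℝ))) • G z
  have hΦ : ∀ ζ : ℂ, 0 < ζ.re →
      ‖Φ ζ‖ = Real.exp (τ * (segAngle s t ζ - ζ.re / (72 * R))) * ‖G ζ‖ := by
    intro ζ hζ
    simp only [Φ, norm_smul, Complex.norm_exp, Complex.re_ofReal_mul, Complex.sub_re,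
      re_segPotential hζ, Complex.div_ofReal_re]
  have himR : z.im < R := by
    refine lt_of_lt_of_le ?_ hzR
    have : |z.im| < ‖z‖ := Complex.abs_im_lt_norm.2 hz.ne'
    exact (le_abs_self _).trans_lt this
  -- For |z| ≤ R the segment is within distance 3R, and (R/2)/(3R)² = 1/(18R) = 1/(24R) + 1/(72R).
  have hlow : z.re / (24 * R) ≤ segAngle s t z - z.re / (72 * R) := by
    obtain ⟨u, ⟨hu1, hu2⟩, h⟩ := exists_segAngle_eq (show s < t by linarith) hz
    rw [h]
    have h3 : z.re ^ 2 + (z.im - u) ^ 2 ≤ 9 * R ^ 2 := by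
      have e : ‖z‖ ^ 2 = z.re ^ 2 + z.im ^ 2 := by
        rw [Complex.sq_norm, Complex.normSq_apply]; ring
      have : ‖z‖ ^ 2 ≤ R ^ 2 := by gcongr
      have : -R ≤ z.im := (abs_le.1 ((Complex.abs_im_le_norm z).trans hzR)).1
      nlinarith
    have h4 : z.re / (9 * R ^ 2) ≤ z.re / (z.re ^ 2 + (z.im - u) ^ 2) := by
      gcongr
    have h5 : (t - s) * (z.re / (9 * R ^ 2)) ≤ (t - s) * (z.re / (z.re ^ 2 + (z.im - u) ^ 2)) := by
      gcongr
      linarith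
    have h6 : (t - s) * (z.re / (9 * R ^ 2)) = z.re / (24 * R) + z.re / (72 * R) := by
      rw [hs, ht]; field_simp; norm_num
    linarith
  have main : ∀ ε : ℝ, 0 < ε → ε < w → ε < z.re → ‖Φ z‖ ≤ A * Real.exp (τ * (ε / w)) := by
    intro ε hε hεw hεz
    -- The box around the segment is cut out. On Re ζ = ε the angle is then at most ε/w, an error
    -- that disappears as ε tends to 0.
    set U : Set ℂ := {ζ | ε < ζ.re} ∩ {ζ | ‖ζ‖ < 8 * R} ∩
      {ζ | w < ζ.re ∨ ζ.im < s - w ∨ t + w < ζ.im} with hU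
    have hcl : closure U ⊆ {ζ | ε ≤ ζ.re} ∩ {ζ | ‖ζ‖ ≤ 8 * R} ∩
        {ζ | w ≤ ζ.re ∨ ζ.im ≤ s - w ∨ t + w ≤ ζ.im} := by
      apply closure_minimal
      · rintro ζ ⟨⟨ha, hb⟩, hc⟩
        refine ⟨⟨le_of_lt (show ε < ζ.re from ha), le_of_lt (show ‖ζ‖ < _ from hb)⟩, ?_⟩
        rcases hc with h | h | h
        · exact Or.inl h.le
        · exact Or.inr (Or.inl h.le)
        · exact Or.inr (Or.inr h.le)
      · refine ((isClosed_le continuous_const Complex.continuous_re).inter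
          (isClosed_le continuous_norm continuous_const)).inter ?_
        exact (isClosed_le continuous_const Complex.continuous_re).union
          ((isClosed_le Complex.continuous_im continuous_const).union
            (isClosed_le continuous_const Complex.continuous_im))
    have hopen : IsOpen U := by
      refine ((isOpen_lt continuous_const Complex.continuous_re).inter
          (isOpen_lt continuous_norm continuous_const)).inter ?_
      exact (isOpen_lt continuous_const Complex.continuous_re).union
          ((isOpen_lt Complex.continuous_im continuous_const).union
            (isOpen_lt continuous_const Complex.continuous_im))
    have hbdd : Bornology.IsBounded U :=
      (Metric.isBounded_ball (x := (0 : ℂ)) (r := 8 * R)).subset fun ζ hζ => by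
        simpa using hζ.1.2
    have hdiff : ∀ ζ ∈ closure U, DifferentiableAt ℂ Φ ζ := by
      intro ζ hζ
      have hζ0 : 0 < ζ.re := hε.trans_le (hcl hζ).1.1
      refine DifferentiableAt.smul ?_ (hG.differentiableAt
        ((isOpen_lt continuous_const Complex.continuous_re).mem_nhds hζ0))
      exact (((differentiableAt_segPotential s t hζ0).sub
        (differentiableAt_id.div_const _)).const_mul _).cexp
    refine Complex.norm_le_of_forall_mem_frontier_norm_le hbdd
      (DifferentiableOn.diffContOnCl fun ζ hζ => (hdiff ζ hζ).differentiableWithinAt) ?_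
      (subset_closure ⟨⟨hεz, by simp only [mem_ofPred_eq]; linarith⟩, Or.inr (Or.inl (by linarith))⟩)
    intro ζ hζ
    rw [hopen.frontier_eq] at hζ
    obtain ⟨⟨⟨ha, hb⟩, hc⟩, hζU⟩ := And.intro (hcl hζ.1) hζ.2
    simp only [mem_ofPred_eq] at ha hb hc
    have hζ0 : 0 < ζ.re := hε.trans_le ha
    have hquot : 0 ≤ ζ.re / (72 * R) := by positivity
    have hgen : ∀ v : ℝ, 0 ≤ v → ‖G ζ‖ ≤ A * Real.exp (-v) →
        τ * (segAngle s t ζ - ζ.re / (72 * R)) ≤ v + τ * (ε / w) →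
        ‖Φ ζ‖ ≤ A * Real.exp (τ * (ε / w)) := by
      intro v hv hv1 hv2
      rw [hΦ ζ hζ0]
      calc _ ≤ Real.exp (v + τ * (ε / w)) * (A * Real.exp (-v)) := by gcongr
        _ = A * (Real.exp (v + τ * (ε / w)) * Real.exp (-v)) := by ring
        _ = _ := by rw [← Real.exp_add]; ring_nf
    by_cases hb' : ‖ζ‖ = 8 * R
    · apply hgen 0 le_rfl (by simpa using h1 ζ hζ0 hb)
      have : segAngle s t ζ ≤ ζ.re / (72 * R) := by
        obtain ⟨u, ⟨hu1, hu2⟩, h⟩ := exists_segAngle_eq (show s < t by linarith) hζ0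
        rw [h]
        have h3 : 36 * R ^ 2 ≤ ζ.re ^ 2 + (ζ.im - u) ^ 2 := by
          have e : ‖ζ‖ ^ 2 = ζ.re ^ 2 + ζ.im ^ 2 := by
            rw [Complex.sq_norm, Complex.normSq_apply]; ring
          rw [hb'] at e
          have : ζ.im ≤ 8 * R := hb' ▸ (le_abs_self _).trans (Complex.abs_im_le_norm ζ)
          nlinarith
        have h4 : ζ.re / (ζ.re ^ 2 + (ζ.im - u) ^ 2) ≤ ζ.re / (36 * R ^ 2) := by
          gcongr
        have h5 : (t - s) * (ζ.re / (ζ.re ^ 2 + (ζ.im - u) ^ 2)) ≤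
            (t - s) * (ζ.re / (36 * R ^ 2)) := by
          gcongr
          linarith
        have h6 : (t - s) * (ζ.re / (36 * R ^ 2)) = ζ.re / (72 * R) := by
          rw [hs, ht]; field_simp; norm_num
        linarith
      have : τ * (segAngle s t ζ - ζ.re / (72 * R)) ≤ 0 :=
        mul_nonpos_of_nonneg_of_nonpos hτ0.le (by linarith)
      have : 0 ≤ τ * (ε / w) := by positivity
      linarith
    have hb'' : ‖ζ‖ < 8 * R := lt_of_le_of_ne hb hb'
    by_cases ha' : ζ.re = ε
    · apply hgen 0 le_rfl (by simpa using h1 ζ hζ0 hb)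
      rw [zero_add]
      gcongr
      have : segAngle s t ζ ≤ ζ.re / w := by
        apply segAngle_le_div hζ0 hw
        rcases hc with h | h
        · linarith
        · exact h
      rw [ha'] at this hquot
      rw [ha']
      linarith
    have ha'' : ε < ζ.re := lt_of_le_of_ne ha (Ne.symm ha')
    have hnot : ¬ (w < ζ.re ∨ ζ.im < s - w ∨ t + w < ζ.im) := fun h => hζU ⟨⟨ha'', hb''⟩, h⟩
    push Not at hnot
    obtain ⟨hn1, hn2, hn3⟩ := hnot
    apply hgen (β * ζ.re) (by positivity)
    · refine h2 ζ hζ0 hn1 ?_ hb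
      have : ζ.im ≤ ‖ζ‖ := (le_abs_self _).trans (Complex.abs_im_le_norm ζ)
      linarith
    have h0 : 0 ≤ τ * (ε / w) := by positivity
    suffices h : τ * segAngle s t ζ ≤ β * ζ.re by
      have : 0 ≤ τ * (ζ.re / (72 * R)) := by positivity
      rw [mul_sub]
      linarith
    by_cases h : ζ.re = w
    · calc τ * segAngle s t ζ ≤ τ * Real.pi := by gcongr; exact segAngle_le_pi _ _ _
        _ = β * ζ.re := by rw [hτ, h]; field_simp
    · have h' : ζ.im ≤ s - w ∨ t + w ≤ ζ.im := by
        rcases hc with h'' | h''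
        · exact absurd (le_antisymm hn1 h'') h
        · exact h''
      calc τ * segAngle s t ζ ≤ τ * (ζ.re / w) := by gcongr; exact segAngle_le_div hζ0 hw h'
        _ = β * ζ.re / Real.pi := by rw [hτ]; field_simp
        _ ≤ β * ζ.re := div_le_self (by positivity) (by linarith [Real.pi_gt_three])
  have hlim : Tendsto (fun ε => A * Real.exp (τ * (ε / w))) (𝓝[>] 0) (𝓝 A) := by
    have : Tendsto (fun ε => A * Real.exp (τ * (ε / w))) (𝓝 0) (𝓝 (A * Real.exp (τ * (0 / w)))) :=
      Continuous.tendsto (by fun_prop) 0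
    simpa using this.mono_left nhdsWithin_le_nhds
  have hΦA : ‖Φ z‖ ≤ A := by
    refine ge_of_tendsto hlim ?_
    filter_upwards [Ioo_mem_nhdsGT hw, Ioo_mem_nhdsGT hz] with ε hε1 hε2
    exact main ε hε1.1 hε1.2 hε2.2
  rw [hΦ z hz] at hΦA
  have h7 : Real.exp (β * w / (24 * Real.pi * R) * z.re) ≤
      Real.exp (τ * (segAngle s t z - z.re / (72 * R))) := by
    rw [Real.exp_le_exp]
    calc _ = τ * (z.re / (24 * R)) := by rw [hτ]; field_simp
      _ ≤ _ := by gcongr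
  rw [Real.exp_neg, ← div_eq_mul_inv, le_div_iff₀ (Real.exp_pos _), mul_comm]
  exact (by gcongr : _ ≤ _).trans hΦA

/-- A maximum principle in a half-disc. -/
theorem norm_le_of_arc {H : ℂ → E} (hH : DifferentiableOn ℂ H {z | 0 < z.re})
    {ρ κ A : ℝ} (b : ℝ → ℝ) (hb : Tendsto b (𝓝[>] 0) (𝓝 1))
    (h1 : ∀ z : ℂ, 0 < z.re → z.re < 1 → ‖z‖ ≤ ρ → ‖H z‖ ≤ A * b z.re)
    (h2 : ∀ z : ℂ, 0 < z.re → ‖z‖ = ρ → ‖H z‖ ≤ A * Real.exp (κ * z.re))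
    {z : ℂ} (hz : 0 < z.re) (hzR : ‖z‖ ≤ ρ) :
    ‖H z‖ ≤ A * Real.exp (κ * z.re) := by
  rcases hzR.eq_or_lt with hzR | hzR
  · exact h2 z hz hzR
  set Φ : ℂ → E := fun z => Complex.exp (-(κ * z)) • H z
  have hΦ : ∀ ζ : ℂ, ‖Φ ζ‖ = Real.exp (-(κ * ζ.re)) * ‖H ζ‖ := by
    intro ζ
    simp only [Φ, norm_smul, Complex.norm_exp, Complex.neg_re, Complex.re_ofReal_mul]
  have main : ∀ ε : ℝ, 0 < ε → ε < 1 → ε < z.re → ‖Φ z‖ ≤ max A (Real.exp (-(κ * ε)) * (A * b ε)) := by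
    intro ε hε hε1 hεz
    set U : Set ℂ := {ζ | ε < ζ.re} ∩ {ζ | ‖ζ‖ < ρ} with hU
    have hcl : closure U ⊆ {ζ | ε ≤ ζ.re} ∩ {ζ | ‖ζ‖ ≤ ρ} := by
      apply closure_minimal
      · rintro ζ ⟨ha, hb⟩
        exact ⟨le_of_lt (show ε < ζ.re from ha), le_of_lt (show ‖ζ‖ < _ from hb)⟩
      · exact (isClosed_le continuous_const Complex.continuous_re).inter
          (isClosed_le continuous_norm continuous_const)
    have hopen : IsOpen U := (isOpen_lt continuous_const Complex.continuous_re).inter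
          (isOpen_lt continuous_norm continuous_const)
    have hbdd : Bornology.IsBounded U :=
      (Metric.isBounded_ball (x := (0 : ℂ)) (r := ρ)).subset fun ζ hζ => by
        simpa using hζ.2
    have hdiff : ∀ ζ ∈ closure U, DifferentiableAt ℂ Φ ζ := by
      intro ζ hζ
      have hζ0 : 0 < ζ.re := hε.trans_le (hcl hζ).1
      refine DifferentiableAt.smul (by fun_prop) (hH.differentiableAt
        ((isOpen_lt continuous_const Complex.continuous_re).mem_nhds hζ0))
    refine Complex.norm_le_of_forall_mem_frontier_norm_le hbdd
      (DifferentiableOn.diffContOnCl fun ζ hζ => (hdiff ζ hζ).differentiableWithinAt) ?_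
      (subset_closure ⟨hεz, hzR⟩)
    intro ζ hζ
    rw [hopen.frontier_eq] at hζ
    obtain ⟨⟨ha, hb⟩, hζU⟩ := And.intro (hcl hζ.1) hζ.2
    simp only [mem_ofPred_eq] at ha hb
    have hζ0 : 0 < ζ.re := hε.trans_le ha
    rw [hΦ]
    by_cases hb' : ‖ζ‖ = ρ
    · refine le_max_of_le_left ?_
      calc _ ≤ Real.exp (-(κ * ζ.re)) * (A * Real.exp (κ * ζ.re)) := by gcongr; exact h2 ζ hζ0 hb'
        _ = A * (Real.exp (-(κ * ζ.re)) * Real.exp (κ * ζ.re)) := by ring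
        _ = A := by rw [← Real.exp_add]; simp
    · have ha' : ζ.re = ε := by
        by_contra h
        exact hζU ⟨lt_of_le_of_ne ha (Ne.symm h), lt_of_le_of_ne hb hb'⟩
      refine le_max_of_le_right ?_
      rw [← ha']
      gcongr
      exact h1 ζ hζ0 (ha' ▸ hε1) hb
  have hlim : Tendsto (fun ε => max A (Real.exp (-(κ * ε)) * (A * b ε))) (𝓝[>] 0) (𝓝 A) := by
    have h3 : Tendsto (fun ε => Real.exp (-(κ * ε))) (𝓝[>] 0) (𝓝 1) := by
      have : Tendsto (fun ε => Real.exp (-(κ * ε))) (𝓝 0) (𝓝 (Real.exp (-(κ * 0)))) :=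
        Continuous.tendsto (by fun_prop) 0
      simpa using this.mono_left nhdsWithin_le_nhds
    simpa using (tendsto_const_nhds (x := A)).max (h3.mul (hb.const_mul A))
  have hΦA : ‖Φ z‖ ≤ A := by
    refine ge_of_tendsto hlim ?_
    filter_upwards [Ioo_mem_nhdsGT hz, Ioo_mem_nhdsGT one_pos] with ε hε hε1
    exact main ε hε.1 hε1.2 hε.2
  rw [hΦ z, Real.exp_neg, inv_mul_le_iff₀ (Real.exp_pos _)] at hΦA
  linarith

end Muntz

/-! ### Improving the decay rate scale by scale. -/

namespace Muntz

variable {E : Type*} [NormedAddCommGroup E] [NormedSpace ℂ E]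

/-- The decay rate improves by the factor `h R / R` when passing from the half-disc of radius `8 R`
to that of radius `R`. -/
theorem norm_le_of_norm_le_eight_mul {H : ℂ → E} (hH : DifferentiableOn ℂ H {z | 0 < z.re})
    {β B A : ℝ} (hβ : 0 < β) (hB : 0 < B) (hA : 0 ≤ A) {h : ℝ → ℝ} (hmono : MonotoneOn h (Ioi 0))
    (hpos : ∀ r, 0 < r → 0 < h r) {b : ℝ → ℝ} (hb : Tendsto b (𝓝[>] 0) (𝓝 1))
    (hhb : ∀ x, 0 < x → x < 1 → (B * x / h x) ^ (β * x) ≤ b x) {R : ℝ} (hR : 0 < R)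
    (hbd : ∀ z : ℂ, 0 < z.re → ‖z‖ ≤ 8 * R → ‖H z‖ ≤ A * (B * z.re / h ‖z‖) ^ (β * z.re))
    {q : ℝ} (hq : 0 ≤ q)
    (hq1 : 0 < q → ∀ z : ℂ, 0 < z.re → ‖z‖ ≤ 8 * R → ‖H z‖ ≤ A * q ^ (-(β * z.re)))
    {z : ℂ} (hz : 0 < z.re) (hzR : ‖z‖ ≤ R) :
    ‖H z‖ ≤ A * (q + h R / (384 * Real.pi * B * R)) ^ (-(β * z.re)) := by
  have hhR := hpos R hR
  have hre : ∀ ζ : ℂ, 0 < ζ.re → ζ.re ≤ ‖ζ‖ := fun ζ _ =>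
    (le_abs_self _).trans (Complex.abs_re_le_norm ζ)
  -- The rate that `hbd` gives on the arc |z| = 8R, where B x/h(8R) ≤ 8BR/h(R). It serves when `q`
  -- is still small, in particular at the start `q = 0`.
  set q₀ := h R / (8 * B * R) with hq₀
  have hq₀0 : 0 < q₀ := by positivity
  set p := max q q₀ with hp
  have hp0 : 0 < p := lt_max_of_lt_right hq₀0
  have hexp : ∀ x : ℝ, p ^ (-(β * x)) = Real.exp (-β * Real.log p * x) := by
    intro x
    rw [Real.rpow_def_of_pos hp0]
    ring_nf
  have hpb : ∀ z : ℂ, 0 < z.re → ‖z‖ ≤ 8 * R → ‖H z‖ ≤ A * p ^ (-(β * z.re)) := by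
    rcases le_total q₀ q with hqq | hqq
    · rw [hp, max_eq_left hqq]
      exact hq1 (hq₀0.trans_le hqq)
    · intro ζ hζ hζR
      rw [hexp]
      refine norm_le_of_arc hH b hb ?_ ?_ hζ hζR
      · intro ξ hξ hξ1 hξR
        refine (hbd ξ hξ hξR).trans ?_
        gcongr
        refine le_trans ?_ (hhb _ hξ hξ1)
        have := hpos _ hξ
        have := hpos _ (hξ.trans_le (hre ξ hξ))
        gcongr
        exact hmono hξ (hξ.trans_le (hre ξ hξ)) (hre ξ hξ)
      · intro ξ hξ hξR
        refine (hbd ξ hξ hξR.le).trans ?_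
        rw [← hexp]
        gcongr
        rw [Real.rpow_neg hp0.le, ← Real.inv_rpow hp0.le]
        have := hpos (8 * R) (by positivity)
        have h8 : h R ≤ h (8 * R) := hmono hR (show 0 < 8 * R by positivity) (by linarith)
        rw [hξR]
        gcongr
        rw [hp, max_eq_right hqq, hq₀, inv_div]
        calc B * ξ.re / h (8 * R) ≤ B * (8 * R) / h R := by
              gcongr
              exact (hre ξ hξ).trans hξR.le
          _ = _ := by ring
  -- For Re ζ ≤ w and |ζ| ≥ R this gives B x/h(|ζ|) ≤ 1/(16p) ≤ e^{-1}/p, which is the rate `p` with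
  -- an extra factor e^{-βx}. The condition w ≤ R/2 amounts to q₀ ≤ p.
  set w := h R / (16 * B * p) with hw
  have hw0 : 0 < w := by positivity
  have hwR : w ≤ R / 2 := by
    have : h R ≤ 8 * B * R * p := by
      have := le_max_right q q₀
      rwa [← hp, hq₀, div_le_iff₀ (by positivity), mul_comm] at this
    rw [hw, div_le_div_iff₀ (by positivity) (by positivity)]
    linarith
  set G : ℂ → E := fun z => Complex.exp (β * Real.log p * z) • H z with hG
  have hGn : ∀ ζ : ℂ, ‖G ζ‖ = Real.exp (β * Real.log p * ζ.re) * ‖H ζ‖ := by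
    intro ζ
    simp only [G, norm_smul, Complex.norm_exp, ← Complex.ofReal_mul, Complex.re_ofReal_mul]
  have hGd : DifferentiableOn ℂ G {z | 0 < z.re} :=
    DifferentiableOn.smul (by fun_prop) hH
  have hmain := norm_le_of_small_near_boundary hGd (A := A) hR hw0 hwR hβ ?_ ?_ hz hzR
  · rw [hGn] at hmain
    have hle : ‖H z‖ ≤ A * Real.exp (-β * Real.log p * z.re) *
        Real.exp (-(β * w / (24 * Real.pi * R) * z.re)) := by
      calc ‖H z‖ = Real.exp (-β * Real.log p * z.re) *
            (Real.exp (β * Real.log p * z.re) * ‖H z‖) := by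
              rw [← mul_assoc, ← Real.exp_add]; ring_nf; simp
        _ ≤ Real.exp (-β * Real.log p * z.re) *
            (A * Real.exp (-(β * w / (24 * Real.pi * R) * z.re))) := by gcongr
        _ = _ := by ring
    refine hle.trans ?_
    rw [mul_assoc, ← Real.exp_add]
    gcongr
    set c := h R / (384 * Real.pi * B * R) with hc
    have hc0 : 0 < c := by positivity
    have hqc : 0 < q + c := by positivity
    rw [Real.rpow_def_of_pos hqc, Real.exp_le_exp]
    -- The gain exp(-βx c/p) depends on `p`, but log p + c/p ≥ log(p + c) turns it into a fixed
    -- additive increment `c`.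
    have h1 : Real.log (q + c) ≤ Real.log p + c / p := by
      calc Real.log (q + c) ≤ Real.log (p + c) := by
            apply Real.log_le_log hqc
            linarith [le_max_left q q₀]
        _ = Real.log (p * (1 + c / p)) := by congr 1; field_simp
        _ = Real.log p + Real.log (1 + c / p) := Real.log_mul hp0.ne' (by positivity)
        _ ≤ _ := by
          gcongr
          have := Real.log_le_sub_one_of_pos (show 0 < 1 + c / p by positivity)
          linarith
    have h2 : β * w / (24 * Real.pi * R) * z.re = β * z.re * (c / p) := by
      rw [hw, hc]; field_simp; norm_num
    have h3 : β * z.re * Real.log (q + c) ≤ β * z.re * (Real.log p + c / p) := by gcongr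
    rw [h2]
    linarith
  · intro ζ hζ hζR
    rw [hGn]
    calc _ ≤ Real.exp (β * Real.log p * ζ.re) * (A * p ^ (-(β * ζ.re))) := by
          gcongr; exact hpb ζ hζ hζR
      _ = A * (Real.exp (β * Real.log p * ζ.re) * Real.exp (-β * Real.log p * ζ.re)) := by
          rw [hexp]; ring
      _ = A := by rw [← Real.exp_add]; ring_nf; simp
  · intro ζ hζ hζw hζR hζR'
    rw [hGn]
    have h1 : B * ζ.re / h ‖ζ‖ ≤ Real.exp (-Real.log p - 1) := by
      have hhζ : h R ≤ h ‖ζ‖ := hmono hR (hR.trans_le hζR) hζR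
      calc B * ζ.re / h ‖ζ‖ ≤ B * w / h R := by gcongr
        _ = 1 / 16 * p⁻¹ := by rw [hw]; field_simp
        _ ≤ Real.exp (-1) * p⁻¹ := by
          gcongr
          rw [Real.exp_neg, one_div]
          gcongr
          linarith [Real.exp_one_lt_d9]
        _ = _ := by
          rw [sub_eq_add_neg, add_comm, Real.exp_add, Real.exp_neg (Real.log p), Real.exp_log hp0]
    calc _ ≤ Real.exp (β * Real.log p * ζ.re) *
          (A * Real.exp (-Real.log p - 1) ^ (β * ζ.re)) := by
          gcongr
          refine (hbd ζ hζ hζR').trans ?_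
          have := hpos _ (hR.trans_le hζR)
          gcongr
      _ = A * (Real.exp (β * Real.log p * ζ.re) *
          Real.exp ((-Real.log p - 1) * (β * ζ.re))) := by
          rw [← Real.exp_mul]; ring
      _ = _ := by rw [← Real.exp_add]; ring_nf

theorem norm_le_unit_half_disc {H : ℂ → E} (hH : DifferentiableOn ℂ H {z | 0 < z.re})
    {β B A : ℝ} (hβ : 0 < β) (hB : 0 < B) (hA : 0 ≤ A) {h : ℝ → ℝ} (hmono : MonotoneOn h (Ioi 0))
    (hpos : ∀ r, 0 < r → 0 < h r) {b : ℝ → ℝ} (hb : Tendsto b (𝓝[>] 0) (𝓝 1))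
    (hhb : ∀ x, 0 < x → x < 1 → (B * x / h x) ^ (β * x) ≤ b x) (N : ℕ)
    (hbd : ∀ z : ℂ, 0 < z.re → ‖z‖ ≤ 8 ^ N → ‖H z‖ ≤ A * (B * z.re / h ‖z‖) ^ (β * z.re))
    (hN : 0 < N) {z : ℂ} (hz : 0 < z.re) (hz1 : ‖z‖ ≤ 1) :
    ‖H z‖ ≤ A * ((384 * Real.pi * B)⁻¹ * ∑ n ∈ Finset.range N, h (8 ^ n) / 8 ^ n) ^
      (-(β * z.re)) := by
  set u : ℕ → ℝ := fun n => h (8 ^ n) / (384 * Real.pi * B * 8 ^ n)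
  have hu : ∀ n, 0 < u n := fun n => by
    have := hpos (8 ^ n) (by positivity)
    positivity
  have key : ∀ j ≤ N, 0 < ∑ n ∈ Finset.Ico (N - j) N, u n →
      ∀ z : ℂ, 0 < z.re → ‖z‖ ≤ 8 ^ (N - j) →
        ‖H z‖ ≤ A * (∑ n ∈ Finset.Ico (N - j) N, u n) ^ (-(β * z.re)) := by
    intro j
    induction j with
    -- At radius 8^N the sum is empty. Its positivity is assumed, so this case is vacuous, and the
    -- first descent runs with q = 0 on `hbd` alone.
    | zero => intro _ h0; simp at h0
    | succ j ih =>
      intro hj _ z hz hzj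
      obtain ⟨i, hi⟩ : ∃ i, N - (j + 1) = i := ⟨_, rfl⟩
      have hi' : N - j = i + 1 := by omega
      rw [hi', pow_succ'] at ih
      rw [hi] at hzj ⊢
      rw [Finset.sum_eq_sum_Ico_succ_bot (show i < N by omega), add_comm]
      refine norm_le_of_norm_le_eight_mul hH hβ hB hA hmono hpos hb hhb (R := 8 ^ i)
        (by positivity) ?_ (Finset.sum_nonneg fun n _ => (hu n).le) (ih (by omega)) hz hzj
      intro ζ hζ hζi
      refine hbd ζ hζ (hζi.trans ?_)
      rw [← pow_succ']
      exact pow_le_pow_right₀ (by norm_num) (by omega)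
  have hsum : (384 * Real.pi * B)⁻¹ * ∑ n ∈ Finset.range N, h (8 ^ n) / 8 ^ n =
      ∑ n ∈ Finset.Ico (N - N) N, u n := by
    rw [Nat.sub_self, ← Finset.range_eq_Ico, Finset.mul_sum]
    refine Finset.sum_congr rfl fun n _ => ?_
    simp only [u]
    field_simp
  rw [hsum]
  refine key N le_rfl ?_ z hz (by simpa using hz1)
  exact Finset.sum_pos (fun n _ => hu n) ⟨0, by simp [hN]⟩

/-- The divergence of `∫ h(r)/r²` passes to a dyadic sum. -/
theorem tendsto_sum_dyadic {h : ℝ → ℝ} (hmono : MonotoneOn h (Ioi 0))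
    (hpos : ∀ r, 0 < r → 0 < h r)
    (hdiv : ∫⁻ r in Ioi (1 : ℝ), ENNReal.ofReal (h r / r ^ 2) = ⊤) :
    Tendsto (fun N => ∑ n ∈ Finset.range N, h (8 ^ n) / 8 ^ n) atTop atTop := by
  set u : ℕ → ℝ := fun n => h (8 ^ n) / 8 ^ n
  have hu : ∀ n, 0 ≤ u n := fun n => by
    have := hpos (8 ^ n) (by positivity)
    positivity
  refine (not_summable_iff_tendsto_nat_atTop_of_nonneg hu).1 fun hs => ?_
  have hcover : Ioi (1 : ℝ) ⊆ ⋃ n : ℕ, Ico ((8 : ℝ) ^ n) (8 ^ (n + 1)) := by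
    intro r hr
    obtain ⟨n, hn⟩ := exists_nat_pow_near (le_of_lt (show (1 : ℝ) < r from hr))
      (show (1 : ℝ) < 8 by norm_num)
    exact mem_iUnion.2 ⟨n, hn⟩
  -- The interval has length 7·8^n and h(r)/r² ≤ h(8^{n+1})/8^{2n} on it; 7·8 = 56.
  have hpiece : ∀ n : ℕ, ∫⁻ r in Ico ((8 : ℝ) ^ n) (8 ^ (n + 1)), ENNReal.ofReal (h r / r ^ 2) ≤
      ENNReal.ofReal (56 * u (n + 1)) := by
    intro n
    calc _ ≤ ∫⁻ r in Ico ((8 : ℝ) ^ n) (8 ^ (n + 1)),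
          ENNReal.ofReal (h (8 ^ (n + 1)) / (8 ^ n) ^ 2) := by
          refine setLIntegral_mono measurable_const fun r hr => ENNReal.ofReal_le_ofReal ?_
          have h8 : (0 : ℝ) < 8 ^ n := by positivity
          have hr0 : 0 < r := h8.trans_le hr.1
          have := (hpos (8 ^ (n + 1)) (by positivity)).le
          have := hr.1
          gcongr
          exact hmono hr0 (show (0 : ℝ) < 8 ^ (n + 1) by positivity) hr.2.le
      _ = ENNReal.ofReal (h (8 ^ (n + 1)) / (8 ^ n) ^ 2) * ENNReal.ofReal (8 ^ (n + 1) - 8 ^ n) := by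
          rw [setLIntegral_const, Real.volume_Ico]
      _ = ENNReal.ofReal (56 * u (n + 1)) := by
          have := hpos (8 ^ (n + 1)) (by positivity)
          rw [← ENNReal.ofReal_mul (by positivity)]
          congr 1
          simp only [u]
          field_simp
          ring
      _ ≤ _ := le_rfl
  have hfin : ∑' n, ENNReal.ofReal (56 * u (n + 1)) ≠ ⊤ :=
    (((summable_nat_add_iff 1).2 hs).mul_left 56).tsum_ofReal_ne_top
  refine hfin (top_unique ?_)
  calc ⊤ = ∫⁻ r in Ioi (1 : ℝ), ENNReal.ofReal (h r / r ^ 2) := hdiv.symm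
    _ ≤ ∫⁻ r in ⋃ n : ℕ, Ico ((8 : ℝ) ^ n) (8 ^ (n + 1)), ENNReal.ofReal (h r / r ^ 2) :=
        lintegral_mono_set hcover
    _ ≤ ∑' n, ∫⁻ r in Ico ((8 : ℝ) ^ n) (8 ^ (n + 1)), ENNReal.ofReal (h r / r ^ 2) :=
        lintegral_iUnion_le _ _
    _ ≤ _ := ENNReal.tsum_le_tsum hpiece

end Muntz

/-! ### Lower bounds for products of modified Blaschke factors. -/

namespace Muntz

theorem sum_inv_sqrt_le (n : ℕ) : ∑ i ∈ Finset.range n, 1 / √((i : ℝ) + 1) ≤ 2 * √n := by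
  induction n with
  | zero => simp
  | succ n ih =>
    rw [Finset.sum_range_succ]
    push_cast
    have h1 : 0 < √((n : ℝ) + 1) := by positivity
    have h2 : √((n : ℝ) + 1) ^ 2 = n + 1 := Real.sq_sqrt (by positivity)
    have h3 : √(n : ℝ) ^ 2 = n := Real.sq_sqrt (by positivity)
    have h4 : 1 / √((n : ℝ) + 1) ≤ 2 * √((n : ℝ) + 1) - 2 * √n := by
      rw [div_le_iff₀ h1]
      nlinarith [sq_nonneg (√((n : ℝ) + 1) - √n)]
    linarith

/-- The logarithm of the modulus of the reciprocal of a Blaschke factor of the half-plane. -/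
noncomputable def blaschkeLog (z : ℂ) (a : ℝ) : ℝ := Real.log (‖(a : ℂ) + z‖ / ‖(a : ℂ) - z‖)

theorem norm_add_sq_eq (z : ℂ) (a : ℝ) :
    ‖(a : ℂ) + z‖ ^ 2 = ‖(a : ℂ) - z‖ ^ 2 + 4 * a * z.re := by
  rw [Complex.sq_norm, Complex.sq_norm, Complex.normSq_apply, Complex.normSq_apply]
  simp
  ring

/-- This is log(1 + v) ≤ v for the square of the quotient, because |a + z|² = |a - z|² + 4ax. -/
theorem blaschkeLog_le {z : ℂ} (hz : 0 < z.re) {a : ℝ} (ha : 0 < a) (hza : 0 < ‖(a : ℂ) - z‖) :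
    blaschkeLog z a ≤ 2 * a * z.re / ‖(a : ℂ) - z‖ ^ 2 := by
  have h1 : (‖(a : ℂ) + z‖ / ‖(a : ℂ) - z‖) ^ 2 = 1 + 4 * a * z.re / ‖(a : ℂ) - z‖ ^ 2 := by
    rw [div_pow, norm_add_sq_eq]
    field_simp
  have h2 : 2 * blaschkeLog z a = Real.log (1 + 4 * a * z.re / ‖(a : ℂ) - z‖ ^ 2) := by
    rw [← h1, Real.log_pow, blaschkeLog]
    norm_num
  have h3 := Real.log_le_sub_one_of_pos (show 0 < 1 + 4 * a * z.re / ‖(a : ℂ) - z‖ ^ 2 by positivity)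
  have h4 : 4 * a * z.re / ‖(a : ℂ) - z‖ ^ 2 = 2 * (2 * a * z.re / ‖(a : ℂ) - z‖ ^ 2) := by ring
  linarith

/-- The convergence factor cancels the first-order term 2x/a. What remains is of order x²/a²,
summable over separated exponents. -/
theorem blaschkeLog_le_far {z : ℂ} (hz : 0 < z.re) {a : ℝ} (ha : 2 * ‖z‖ ≤ a) :
    blaschkeLog z a - 2 * z.re / a ≤ 16 * z.re ^ 2 / a ^ 2 := by
  have hzn : z.re ≤ ‖z‖ := (le_abs_self _).trans (Complex.abs_re_le_norm z)
  have ha0 : 0 < a := by linarith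
  have hD : a / 2 ≤ ‖(a : ℂ) - z‖ := by
    have := norm_sub_norm_le (a : ℂ) z
    rw [Complex.norm_real, Real.norm_of_nonneg ha0.le] at this
    linarith
  have hD0 : 0 < ‖(a : ℂ) - z‖ := by linarith
  have h1 := blaschkeLog_le hz ha0 hD0
  have h2 : ‖(a : ℂ) - z‖ ^ 2 = a ^ 2 - 2 * a * z.re + ‖z‖ ^ 2 := by
    rw [Complex.sq_norm, Complex.sq_norm, Complex.normSq_apply, Complex.normSq_apply]
    simp
    ring
  have h3 : 2 * a * z.re / ‖(a : ℂ) - z‖ ^ 2 - 2 * z.re / a ≤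
      4 * z.re ^ 2 / ‖(a : ℂ) - z‖ ^ 2 := by
    rw [sub_le_iff_le_add, div_add_div _ _ (by positivity) ha0.ne',
      div_le_div_iff₀ (by positivity) (by positivity)]
    have : 0 ≤ 2 * z.re * ‖z‖ ^ 2 * ‖(a : ℂ) - z‖ ^ 2 := by positivity
    have e : 4 * z.re ^ 2 * a + ‖(a : ℂ) - z‖ ^ 2 * (2 * z.re) =
      2 * a * z.re * a + 2 * z.re * ‖z‖ ^ 2 := by rw [h2]; ring
    rw [e]
    nlinarith
  have h4 : 4 * z.re ^ 2 / ‖(a : ℂ) - z‖ ^ 2 ≤ 4 * z.re ^ 2 / (a / 2) ^ 2 := by gcongr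
  have h5 : 4 * z.re ^ 2 / (a / 2) ^ 2 = 16 * z.re ^ 2 / a ^ 2 := by field_simp; norm_num
  linarith

/-- Such z lies at distance at least |Im z| ≥ (√3/2)|z| from the real axis, so no exponent is close
to it. -/
theorem blaschkeLog_le_of_re_le {z : ℂ} (hz : 0 < z.re) (hz2 : z.re ≤ ‖z‖ / 2) {a : ℝ}
    (ha0 : 0 < a) (ha : a < 2 * ‖z‖) :
    blaschkeLog z a ≤ 16 / 3 * (z.re / ‖z‖) := by
  have hz0 : 0 < ‖z‖ := by linarith
  have h2 : 3 / 4 * ‖z‖ ^ 2 ≤ ‖(a : ℂ) - z‖ ^ 2 := by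
    rw [Complex.sq_norm, Complex.sq_norm, Complex.normSq_apply, Complex.normSq_apply]
    have e : ‖z‖ ^ 2 = z.re ^ 2 + z.im ^ 2 := by
      rw [Complex.sq_norm, Complex.normSq_apply]; ring
    simp
    nlinarith [sq_nonneg (a - z.re)]
  have hD0 : 0 < ‖(a : ℂ) - z‖ := by
    by_contra h
    have : ‖(a : ℂ) - z‖ = 0 := le_antisymm (not_lt.1 h) (norm_nonneg _)
    rw [this] at h2
    nlinarith
  calc _ ≤ 2 * a * z.re / ‖(a : ℂ) - z‖ ^ 2 := blaschkeLog_le hz ha0 hD0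
    _ ≤ 2 * (2 * ‖z‖) * z.re / (3 / 4 * ‖z‖ ^ 2) := by gcongr
    _ = _ := by field_simp; norm_num

/-- The logarithmic singularity is dominated by an inverse square root through log u = 2 log √u ≤
2√u. Inverse square roots of distances to separated points have easily bounded sums. -/
theorem blaschkeLog_le_sqrt {z : ℂ} {a : ℝ} (hz : 0 < z.re)
    (ha0 : 0 < a) (ha : a < 2 * ‖z‖) (hza : 0 < ‖(a : ℂ) - z‖) :
    blaschkeLog z a ≤ 2 * √(3 * ‖z‖) * (1 / √‖(a : ℂ) - z‖) := by
  have h1 : ‖(a : ℂ) + z‖ ≤ 3 * ‖z‖ := by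
    have := norm_add_le (a : ℂ) z
    rw [Complex.norm_real, Real.norm_of_nonneg ha0.le] at this
    linarith
  have h0 : 0 < ‖(a : ℂ) + z‖ := by
    refine lt_of_lt_of_le ?_ ((le_abs_self _).trans (Complex.abs_re_le_norm _))
    simp
    positivity
  have h2 : 0 < ‖(a : ℂ) + z‖ / ‖(a : ℂ) - z‖ := by positivity
  have h3 : blaschkeLog z a = 2 * Real.log √(‖(a : ℂ) + z‖ / ‖(a : ℂ) - z‖) := by
    rw [Real.log_sqrt h2.le, blaschkeLog]
    ring
  have h4 := Real.log_le_sub_one_of_pos (Real.sqrt_pos.2 h2)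
  have h5 : √(‖(a : ℂ) + z‖ / ‖(a : ℂ) - z‖) ≤ √(3 * ‖z‖ / ‖(a : ℂ) - z‖) := by gcongr
  rw [Real.sqrt_div (by positivity) (y := ‖(a : ℂ) - z‖) (x := 3 * ‖z‖)] at h5
  have h6 : 2 * √(3 * ‖z‖) * (1 / √‖(a : ℂ) - z‖) = 2 * (√(3 * ‖z‖) / √‖(a : ℂ) - z‖) := by ring
  linarith

section Separated

variable {a : ℕ → ℝ} {d : ℝ}

theorem sub_le_of_separated (ha : ∀ k, d ≤ a (k + 1) - a k) {j k : ℕ} (hjk : j ≤ k) :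
    ((k - j : ℕ) : ℝ) * d ≤ a k - a j := by
  induction k, hjk using Nat.le_induction with
  | base => simp
  | succ k hk ih =>
    have := ha k
    rw [Nat.succ_sub hk]
    push_cast at ih ⊢
    linarith

theorem succ_mul_le_of_separated (ha0 : d ≤ a 0) (ha : ∀ k, d ≤ a (k + 1) - a k) (k : ℕ) :
    ((k : ℝ) + 1) * d ≤ a k := by
  have := sub_le_of_separated ha (Nat.zero_le k)
  rw [Nat.sub_zero] at this
  linarith

theorem exists_le_of_separated (hd : 0 < d) (ha0 : d ≤ a 0) (ha : ∀ k, d ≤ a (k + 1) - a k)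
    (x : ℝ) : ∃ k, x ≤ a k := by
  obtain ⟨k, hk⟩ := exists_nat_ge (x / d)
  refine ⟨k, ?_⟩
  have := succ_mul_le_of_separated ha0 ha k
  rw [div_le_iff₀ hd] at hk
  linarith

theorem strictMono_of_separated (hd : 0 < d) (ha : ∀ k, d ≤ a (k + 1) - a k) : StrictMono a :=
  strictMono_nat_of_lt_succ fun k => by linarith [ha k]

theorem exists_threshold (hd : 0 < d) (ha0 : d ≤ a 0) (ha : ∀ k, d ≤ a (k + 1) - a k)
    (x : ℝ) : ∃ n, ∀ k, k < n ↔ a k < x := by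
  classical
  have hex := exists_le_of_separated hd ha0 ha x
  refine ⟨Nat.find hex, fun k => ⟨fun hk => not_le.1 (Nat.find_min hex hk), fun hk => ?_⟩⟩
  by_contra h
  have := (strictMono_of_separated hd ha).monotone (not_lt.1 h)
  linarith [Nat.find_spec hex]

/-- The reciprocal square roots of the distances to separated points. -/
theorem sum_inv_sqrt_dist_le (hd : 0 < d) (ha0 : d ≤ a 0) (ha : ∀ k, d ≤ a (k + 1) - a k)
    {δ : ℝ} (hδ : 0 < δ) (hδd : δ ≤ d) {x : ℝ} {n : ℕ} (hxn : x ≤ a n) {D : ℕ → ℝ}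
    (hD : ∀ k < n, δ ≤ D k) (hD' : ∀ k < n, |a k - x| ≤ D k) :
    ∑ k ∈ Finset.range n, 1 / √(D k) ≤ 8 / √δ * √n := by
  obtain ⟨j, hj⟩ := exists_threshold hd ha0 ha x
  have hjn : j ≤ n := by
    by_contra h
    have := (hj n).1 (not_le.1 h)
    linarith
  have hterm : ∀ k < n, ∀ i : ℕ, (i : ℝ) * d ≤ |a k - x| →
      1 / √(D k) ≤ 2 / √δ * (1 / √((i : ℝ) + 1)) := by
    intro k hk i hi
    -- `D k` is at least both δ and iδ, hence at least their mean. Keeping δ avoids a zero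
    -- denominator at the nearest point i = 0.
    have h1 : δ * (i + 1) / 2 ≤ D k := by
      have h2 := hD k hk
      have h3 := hD' k hk
      have h4 : (i : ℝ) * δ ≤ i * d := by gcongr
      linarith
    have h5 : √(δ * (i + 1) / 4) ≤ √(D k) := by
      apply Real.sqrt_le_sqrt
      have : 0 ≤ δ * (i + 1) := by positivity
      linarith
    have h6 : √(δ * (i + 1) / 4) = √δ * √((i : ℝ) + 1) / 2 := by
      rw [Real.sqrt_div (by positivity), Real.sqrt_mul hδ.le]
      congr 1
      rw [show (4 : ℝ) = 2 ^ 2 by norm_num, Real.sqrt_sq (by norm_num)]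
    rw [h6] at h5
    calc 1 / √(D k) ≤ 1 / (√δ * √((i : ℝ) + 1) / 2) := by gcongr
      _ = _ := by field_simp
  have hS : ∀ i ≤ n, ∑ l ∈ Finset.range i, 2 / √δ * (1 / √((l : ℝ) + 1)) ≤ 4 / √δ * √n := by
    intro i hi
    rw [← Finset.mul_sum]
    calc _ ≤ 2 / √δ * (2 * √(i : ℝ)) := by gcongr; exact sum_inv_sqrt_le i
      _ ≤ 2 / √δ * (2 * √(n : ℝ)) := by gcongr
      _ = _ := by ring
  rw [← Finset.sum_range_add_sum_Ico _ hjn]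
  have hleft : ∑ k ∈ Finset.range j, 1 / √(D k) ≤ 4 / √δ * √n := by
    refine le_trans ?_ (hS j hjn)
    rw [← Finset.sum_range_reflect (fun l : ℕ => 2 / √δ * (1 / √((l : ℝ) + 1)))]
    refine Finset.sum_le_sum fun k hk => ?_
    have hkj := Finset.mem_range.1 hk
    refine hterm k (hkj.trans_le hjn) _ ?_
    have h1 := sub_le_of_separated ha (show k ≤ j - 1 by omega)
    have h2 := (hj (j - 1)).1 (by omega)
    rw [abs_sub_comm]
    exact le_trans (by linarith) (le_abs_self _)
  have hright : ∑ k ∈ Finset.Ico j n, 1 / √(D k) ≤ 4 / √δ * √n := by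
    refine le_trans ?_ (hS (n - j) (Nat.sub_le _ _))
    rw [Finset.sum_Ico_eq_sum_range]
    refine Finset.sum_le_sum fun i hi => ?_
    have hin := Finset.mem_range.1 hi
    refine hterm (j + i) (by omega) _ ?_
    have h1 := sub_le_of_separated ha (Nat.le_add_right j i)
    have h2 : x ≤ a j := not_lt.1 fun h => lt_irrefl j ((hj j).2 h)
    rw [Nat.add_sub_cancel_left] at h1
    exact le_trans (by linarith) (le_abs_self _)
  calc _ ≤ 4 / √δ * √n + 4 / √δ * √n := add_le_add hleft hright
    _ = _ := by ring

/-- The first ⌊r/d⌋ indices are bounded through a_k ≥ 2r, the others through a_k ≥ (k + 1)d. The two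
parts give 1/(4rd) and 2/(rd). -/
theorem sum_inv_sq_le (hd : 0 < d) (ha0 : d ≤ a 0) (ha : ∀ k, d ≤ a (k + 1) - a k)
    {r : ℝ} (hr : 0 < r) (n : ℕ) :
    ∑ k ∈ Finset.range n with 2 * r ≤ a k, 1 / a k ^ 2 ≤ 9 / (4 * r * d) := by
  set j := ⌊r / d⌋₊ with hj
  have hj1 : (j : ℝ) ≤ r / d := Nat.floor_le (by positivity)
  have hj2 : r / d < j + 1 := Nat.lt_floor_add_one _
  have hak := succ_mul_le_of_separated ha0 ha
  calc _ ≤ ∑ k ∈ Finset.range n, ((if k < j then 1 / (4 * r ^ 2) else 0) +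
        if k < j then 0 else 1 / d ^ 2 * (((k + 1 : ℕ) : ℝ) ^ 2)⁻¹) := by
        rw [Finset.sum_filter]
        refine Finset.sum_le_sum fun k _ => ?_
        split_ifs with h1 h2 h2
        · rw [add_zero]
          have : (2 * r) ^ 2 ≤ a k ^ 2 := by gcongr
          gcongr
          linarith
        · rw [zero_add]
          have h3 : (((k : ℝ) + 1) * d) ^ 2 ≤ a k ^ 2 := by gcongr; exact hak k
          calc 1 / a k ^ 2 ≤ 1 / (((k : ℝ) + 1) * d) ^ 2 := by gcongr
            _ = _ := by push_cast; field_simp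
        · positivity
        · positivity
    _ ≤ j * (1 / (4 * r ^ 2)) + 1 / d ^ 2 * (2 / (j + 1)) := by
        rw [Finset.sum_add_distrib]
        gcongr
        · rw [← Finset.sum_filter, Finset.sum_const, nsmul_eq_mul]
          gcongr
          calc _ ≤ (Finset.range j).card := Finset.card_le_card fun k hk => by
                simpa using (Finset.mem_filter.1 hk).2
            _ = j := Finset.card_range j
        · calc _ = ∑ k ∈ Finset.range n with ¬ k < j, 1 / d ^ 2 * (((k + 1 : ℕ) : ℝ) ^ 2)⁻¹ := by
                rw [Finset.sum_filter]
                refine Finset.sum_congr rfl fun k _ => ?_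
                split_ifs <;> rfl
            _ = 1 / d ^ 2 * ∑ k ∈ Finset.range n with ¬ k < j, (((k + 1 : ℕ) : ℝ) ^ 2)⁻¹ := by
                rw [Finset.mul_sum]
            _ ≤ 1 / d ^ 2 * ∑ i ∈ Finset.Ioo j (n + 1), ((i : ℝ) ^ 2)⁻¹ := by
                gcongr
                rw [← Finset.sum_image (s := (Finset.range n).filter fun k => ¬ k < j)
                  (g := fun k => k + 1) (f := fun i : ℕ => ((i : ℝ) ^ 2)⁻¹) (by simp)]
                refine Finset.sum_le_sum_of_subset_of_nonneg ?_ fun _ _ _ => by positivity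
                intro i hi
                simp only [Finset.mem_image, Finset.mem_filter, Finset.mem_range] at hi
                obtain ⟨k, ⟨h1, h2⟩, rfl⟩ := hi
                rw [Finset.mem_Ioo]
                omega
            _ ≤ _ := by gcongr; exact sum_Ioo_inv_sq_le j (n + 1)
    _ ≤ r / d * (1 / (4 * r ^ 2)) + 1 / d ^ 2 * (2 / (r / d)) := by gcongr
    _ = _ := by field_simp; norm_num

/-- The term 1/a_0 covers the special value of `m` for r ≤ a_0, where the sum itself is empty; for
larger r it is slack. -/
theorem m_le (hd : 0 < d) (ha0 : d ≤ a 0) (ha : ∀ k, d ≤ a (k + 1) - a k) {r : ℝ} {n : ℕ}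
    (hrn : r ≤ a n) : m a r ≤ 1 / a 0 + ∑ k ∈ Finset.range n with a k < r, 1 / a k := by
  have hpos : ∀ k, 0 < a k := fun k =>
    lt_of_lt_of_le (by positivity) (succ_mul_le_of_separated ha0 ha k)
  have hS : 0 ≤ ∑ k ∈ Finset.range n with a k < r, 1 / a k :=
    Finset.sum_nonneg fun k _ => by have := hpos k; positivity
  unfold m
  split_ifs with h
  · linarith
  · rw [tsum_eq_sum (s := Finset.range n), ← Finset.sum_filter]
    · have := hpos 0
      have : 0 ≤ 1 / a 0 := by positivity
      linarith
    · intro k hk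
      rw [Finset.mem_range, not_lt] at hk
      have := (strictMono_of_separated hd ha).monotone hk
      rw [if_neg (by linarith)]

/-- The modulus of a finite product of modified Blaschke factors. -/
noncomputable def blaschkeNorm (a : ℕ → ℝ) (n : ℕ) (z : ℂ) : ℝ :=
  ∏ k ∈ Finset.range n, ‖(a k : ℂ) - z‖ / ‖(a k : ℂ) + z‖ * Real.exp (2 * z.re / a k)

/-- Exponents with a_k < |z| produce exactly the factors e^{2x/a_k} counted by `m`. The rest of the
logarithm is O(x), uniformly in `n`: exponents beyond 2|z| contribute second-order terms, and those
below 2|z| are treated according to whether z is close to the imaginary axis or to the real one. -/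
theorem exp_mul_m_le (hd : 0 < d) (ha0 : d ≤ a 0) (ha : ∀ k, d ≤ a (k + 1) - a k)
    {δ : ℝ} (hδ : 0 < δ) (hδd : δ ≤ d) {n : ℕ} {z : ℂ} (hz : 0 < z.re) (hzn : ‖z‖ ≤ a n)
    (hza : ∀ k < n, δ ≤ ‖(a k : ℂ) - z‖) :
    Real.exp (2 * z.re * m a ‖z‖) ≤
      Real.exp ((2 / a 0 + 36 / d + 80 / δ) * z.re) * blaschkeNorm a n z := by
  have hpos : ∀ k, 0 < a k := fun k =>
    lt_of_lt_of_le (by positivity) (succ_mul_le_of_separated ha0 ha k)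
  have hre : z.re ≤ ‖z‖ := (le_abs_self _).trans (Complex.abs_re_le_norm z)
  have hr : 0 < ‖z‖ := hz.trans_le hre
  have hprod : blaschkeNorm a n z =
      Real.exp (∑ k ∈ Finset.range n, (2 * z.re / a k - blaschkeLog z (a k))) := by
    rw [Real.exp_sum, blaschkeNorm]
    refine Finset.prod_congr rfl fun k hk => ?_
    have h1 : 0 < ‖(a k : ℂ) - z‖ := hδ.trans_le (hza k (Finset.mem_range.1 hk))
    have h2 : 0 < ‖(a k : ℂ) + z‖ := by
      refine lt_of_lt_of_le ?_ ((le_abs_self _).trans (Complex.abs_re_le_norm _))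
      simp
      linarith [hpos k]
    rw [Real.exp_sub, blaschkeLog, Real.exp_log (by positivity)]
    field_simp
  rw [hprod, ← Real.exp_add, Real.exp_le_exp]
  have hm := m_le hd ha0 ha hzn
  -- splitting according to the size of `a k`
  have hsplit : ∑ k ∈ Finset.range n, (blaschkeLog z (a k) - 2 * z.re / a k) +
      2 * z.re * ∑ k ∈ Finset.range n with a k < ‖z‖, 1 / a k ≤
      ∑ k ∈ Finset.range n with 2 * ‖z‖ ≤ a k, 16 * z.re ^ 2 * (1 / a k ^ 2) +
      ∑ k ∈ Finset.range n with a k < 2 * ‖z‖, blaschkeLog z (a k) := by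
    rw [Finset.mul_sum, Finset.sum_filter, Finset.sum_filter, Finset.sum_filter,
      ← Finset.sum_add_distrib, ← Finset.sum_add_distrib]
    refine Finset.sum_le_sum fun k _ => ?_
    have h0 : 0 < z.re / a k := div_pos hz (hpos k)
    rcases le_or_gt (2 * ‖z‖) (a k) with h | h
    · rw [if_neg (by linarith), if_pos h, if_neg (by linarith)]
      have := blaschkeLog_le_far hz h
      have e : 16 * z.re ^ 2 * (1 / a k ^ 2) = 16 * z.re ^ 2 / a k ^ 2 := by ring
      linarith
    · rw [if_neg (not_le.2 h), if_pos h]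
      have e : 2 * z.re * (1 / a k) = 2 * z.re / a k := by ring
      have e' : 2 * z.re / a k = 2 * (z.re / a k) := by ring
      split_ifs <;> linarith
  have hfar : ∑ k ∈ Finset.range n with 2 * ‖z‖ ≤ a k, 16 * z.re ^ 2 * (1 / a k ^ 2) ≤
      36 / d * z.re := by
    rw [← Finset.mul_sum]
    calc _ ≤ 16 * z.re ^ 2 * (9 / (4 * ‖z‖ * d)) := by gcongr; exact sum_inv_sq_le hd ha0 ha hr n
      _ = 36 / d * z.re * (z.re / ‖z‖) := by field_simp; norm_num
      _ ≤ 36 / d * z.re * 1 := by gcongr; exact div_le_one_of_le₀ hre hr.le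
      _ = _ := mul_one _
  have hnear : ∑ k ∈ Finset.range n with a k < 2 * ‖z‖, blaschkeLog z (a k) ≤ 80 / δ * z.re := by
    obtain ⟨j, hj⟩ := exists_threshold hd ha0 ha (2 * ‖z‖)
    have hset : (Finset.range n).filter (fun k => a k < 2 * ‖z‖) = Finset.range (min n j) := by
      ext k
      simp [← hj]
    rw [hset]
    set i := min n j with hi
    have hid : (i : ℝ) ≤ 2 * ‖z‖ / d := by
      rw [le_div_iff₀ hd]
      rcases Nat.eq_zero_or_pos i with h | h
      · rw [h]; simp
      · have h1 := (hj (i - 1)).1 (by omega)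
        have h2 := succ_mul_le_of_separated ha0 ha (i - 1)
        rw [Nat.cast_sub h] at h2
        push_cast at h2
        linarith
    have hk : ∀ k ∈ Finset.range i, k < n ∧ a k < 2 * ‖z‖ := by
      intro k hk
      rw [Finset.mem_range, hi, lt_min_iff] at hk
      exact ⟨hk.1, (hj k).1 hk.2⟩
    rcases le_or_gt z.re (‖z‖ / 2) with h | h
    · calc _ ≤ ∑ k ∈ Finset.range i, 16 / 3 * (z.re / ‖z‖) :=
            Finset.sum_le_sum fun k hk' => blaschkeLog_le_of_re_le hz h (hpos k) (hk k hk').2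
        _ = i * (16 / 3 * (z.re / ‖z‖)) := by simp
        _ ≤ 2 * ‖z‖ / d * (16 / 3 * (z.re / ‖z‖)) := by gcongr
        _ = 32 / 3 / d * z.re := by field_simp; norm_num
        _ ≤ 80 / δ * z.re := by gcongr; norm_num
    · have hxi : z.re ≤ a i := by
        rcases le_total n j with h' | h'
        · rw [hi, min_eq_left h']; linarith
        · rw [hi, min_eq_right h']
          have : ¬ a j < 2 * ‖z‖ := fun hh => lt_irrefl j ((hj j).2 hh)
          linarith
      have hs := sum_inv_sqrt_dist_le hd ha0 ha hδ hδd hxi (D := fun k => ‖(a k : ℂ) - z‖)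
        (fun k hk' => hza k (hk k (Finset.mem_range.2 hk')).1)
        (fun k _ => by simpa using Complex.abs_re_le_norm ((a k : ℂ) - z))
      calc _ ≤ ∑ k ∈ Finset.range i, 2 * √(3 * ‖z‖) * (1 / √‖(a k : ℂ) - z‖) :=
            Finset.sum_le_sum fun k hk' => blaschkeLog_le_sqrt hz (hpos k) (hk k hk').2
              (hδ.trans_le (hza k (hk k hk').1))
        _ ≤ 2 * √(3 * ‖z‖) * (8 / √δ * √i) := by rw [← Finset.mul_sum]; gcongr
        _ ≤ 2 * √(3 * ‖z‖) * (8 / √δ * √(2 * ‖z‖ / δ)) := by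
            gcongr
            exact hid.trans (by gcongr)
        _ = 16 * (√(3 * ‖z‖) * √(2 * ‖z‖)) / (√δ * √δ) := by
            rw [Real.sqrt_div (by positivity)]; field_simp; norm_num
        _ ≤ 16 * (5 / 2 * ‖z‖) / δ := by
            rw [Real.mul_self_sqrt hδ.le, ← Real.sqrt_mul (by positivity)]
            gcongr
            apply Real.sqrt_le_iff.2 ⟨by positivity, ?_⟩
            nlinarith
        _ = 80 / δ * (‖z‖ / 2) := by ring
        _ ≤ 80 / δ * z.re := by gcongr
  have h1 : 2 * z.re * m a ‖z‖ ≤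
      2 * z.re * (1 / a 0 + ∑ k ∈ Finset.range n with a k < ‖z‖, 1 / a k) := by gcongr
  have h2 : ∑ k ∈ Finset.range n, (2 * z.re / a k - blaschkeLog z (a k)) =
      - ∑ k ∈ Finset.range n, (blaschkeLog z (a k) - 2 * z.re / a k) := by
    rw [← Finset.sum_neg_distrib]
    exact Finset.sum_congr rfl fun k _ => by ring
  rw [h2]
  have h3 : 2 / a 0 * z.re = 2 * z.re * (1 / a 0) := by ring
  nlinarith

end Separated

end Muntz

/-! ### Consequences of doubling for h. -/

namespace Muntz

section Growth

variable {h : ℝ → ℝ}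

/-- Iterated doubling with D ≤ 2^k; the additional 2^k pays for rounding s/r up to a power of two.
-/
theorem exists_polynomial_growth (hmono : MonotoneOn h (Ioi 0)) (hpos : ∀ r, 0 < r → 0 < h r)
    {D : ℝ} (hD : ∀ r, 0 < r → h (2 * r) ≤ D * h r) :
    ∃ k : ℕ, ∀ r s, 0 < r → r ≤ s → h s ≤ 2 ^ k * (s / r) ^ k * h r := by
  obtain ⟨k, hk⟩ := pow_unbounded_of_one_lt D (show (1 : ℝ) < 2 by norm_num)
  have hpow : ∀ (j : ℕ) (r : ℝ), 0 < r → h (2 ^ j * r) ≤ (2 ^ k) ^ j * h r := by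
    intro j r hr
    induction j with
    | zero => simp
    | succ j ih =>
      have h1 := hD (2 ^ j * r) (by positivity)
      have h0 := hpos (2 ^ j * r) (by positivity)
      calc h (2 ^ (j + 1) * r) = h (2 * (2 ^ j * r)) := by ring_nf
        _ ≤ D * h (2 ^ j * r) := h1
        _ ≤ 2 ^ k * ((2 ^ k) ^ j * h r) := by gcongr
        _ = _ := by ring
  refine ⟨k, fun r s hr hrs => ?_⟩
  obtain ⟨j, hj1, hj2⟩ := exists_nat_pow_near ((one_le_div hr).2 hrs) (show (1 : ℝ) < 2 by norm_num)
  rw [div_lt_iff₀ hr] at hj2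
  have h0 := hpos r hr
  calc h s ≤ h (2 ^ (j + 1) * r) :=
        hmono (hr.trans_le hrs) (show 0 < 2 ^ (j + 1) * r by positivity) hj2.le
    _ ≤ (2 ^ k) ^ (j + 1) * h r := hpow _ _ hr
    _ = 2 ^ k * (2 ^ j) ^ k * h r := by ring
    _ ≤ _ := by gcongr

/-- Near 0 the function h is bounded below by a multiple of x^k, so the exponent is O(x|log x| + x).
This controls the boundary values on the lines Re z = ε as ε tends to 0. -/
theorem exists_tendsto_one_bound (hpos : ∀ r, 0 < r → 0 < h r) {k : ℕ}
    (hgrow : ∀ r s, 0 < r → r ≤ s → h s ≤ 2 ^ k * (s / r) ^ k * h r) {β B : ℝ} (hβ : 0 < β)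
    (hB : 0 < B) :
    ∃ b : ℝ → ℝ, Tendsto b (𝓝[>] 0) (𝓝 1) ∧
      ∀ x, 0 < x → x < 1 → (B * x / h x) ^ (β * x) ≤ b x := by
  have h1 := hpos 1 one_pos
  set K := B * 2 ^ k / h 1 with hK
  have hK0 : 0 < K := by positivity
  refine ⟨fun x => Real.exp (β * (Real.log K * x + (1 - k) * (Real.log x * x))), ?_, ?_⟩
  · have hid : Tendsto (fun x : ℝ => x) (𝓝[>] 0) (𝓝 0) := nhdsWithin_le_nhds
    have hlog : Tendsto (fun x : ℝ => Real.log x * x) (𝓝[>] 0) (𝓝 0) := by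
      simpa using tendsto_log_mul_rpow_nhdsGT_zero one_pos
    have := (((hid.const_mul (Real.log K)).add (hlog.const_mul (1 - k : ℝ))).const_mul β).rexp
    simpa using this
  · intro x hx hx1
    have hx' := hpos x hx
    have h2 : B * x / h x ≤ K * x / x ^ k := by
      have := hgrow x 1 hx hx1.le
      rw [hK, div_le_div_iff₀ hx' (by positivity)]
      calc B * x * x ^ k = B * x * x ^ k / h 1 * h 1 := by field_simp
        _ ≤ B * x * x ^ k / h 1 * (2 ^ k * (1 / x) ^ k * h x) := by gcongr
        _ = _ := by rw [one_div, inv_pow]; field_simp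
    calc (B * x / h x) ^ (β * x) ≤ (K * x / x ^ k) ^ (β * x) := by gcongr
      _ = _ := by
        rw [Real.rpow_def_of_pos (by positivity), Real.log_div (by positivity) (by positivity),
          Real.log_mul hK0.ne' hx.ne', Real.log_pow]
        ring_nf

/-- Carries the bound for H from a circle around a zero to points inside it. Both y = B₁x/h(r) and
1/y are at most K e^x, so changing the exponent by 2βδ costs a constant and e^{2βδx}; the latter is
absorbed by multiplying the base by e^{2δ}. -/
theorem exists_rpow_le_rpow_of_near (hmono : MonotoneOn h (Ioi 0)) (hpos : ∀ r, 0 < r → 0 < h r)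
    {k : ℕ} (hgrow : ∀ r s, 0 < r → r ≤ s → h s ≤ 2 ^ k * (s / r) ^ k * h r) {β B δ : ℝ}
    (hβ : 0 < β) (hB : 0 < B) (hδ : 0 < δ) :
    ∃ A' B' : ℝ, 1 ≤ A' ∧ B ≤ B' ∧ ∀ x x' r r' : ℝ, 7 * δ ≤ x → |x' - x| ≤ 2 * δ → x' ≤ r' →
      x ≤ r → r ≤ 2 * x → (B * x' / h r') ^ (β * x') ≤ A' * (B' * x / h r) ^ (β * x) := by
  have h7 := hpos (7 * δ) (by positivity)
  set B₁ := 2 * B * 8 ^ k with hB₁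
  have hB₁0 : 0 < B₁ := by positivity
  set K₁ := B₁ / h (7 * δ)
  set K₂ := 2 ^ k * (2 / (7 * δ)) ^ k * h (7 * δ) / (B₁ * (7 * δ)) * k.factorial
  set K := max 1 (max K₁ K₂)
  have hK1 : 1 ≤ K := le_max_left _ _
  have hK0 : 0 < K := by linarith
  refine ⟨K ^ (2 * β * δ), B₁ * Real.exp (2 * δ), Real.one_le_rpow hK1 (by positivity), ?_, ?_⟩
  · calc B ≤ B * (2 * 8 ^ k * Real.exp (2 * δ)) := by
          apply le_mul_of_one_le_right hB.le
          have h1 : (1 : ℝ) ≤ 8 ^ k := one_le_pow₀ (by norm_num)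
          have h2 : 1 ≤ Real.exp (2 * δ) := Real.one_le_exp (by positivity)
          nlinarith
      _ = _ := by rw [hB₁]; ring
  intro x x' r r' hx hx' hxr' hxr hrx
  obtain ⟨hx'1, hx'2⟩ := abs_le.1 hx'
  have hx0 : 0 < x := by linarith
  have hx'0 : 0 < x' := by linarith
  have hr' : 0 < r' := by linarith
  have hr : 0 < r := by linarith
  have hhr := hpos r hr
  have hhr' := hpos r' hr'
  have h1 : h r ≤ 8 ^ k * h r' := by
    have hx2 : 0 < x / 2 := by linarith
    calc h r ≤ h (2 * x) := hmono hr (show 0 < 2 * x by linarith) hrx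
      _ ≤ 2 ^ k * (2 * x / (x / 2)) ^ k * h (x / 2) := hgrow _ _ hx2 (by linarith)
      _ = 8 ^ k * h (x / 2) := by
        rw [← mul_pow]
        congr 2
        field_simp
        norm_num
      _ ≤ 8 ^ k * h r' := by gcongr; exact hmono hx2 hr' (by linarith)
  set y := B₁ * x / h r with hy
  have hy0 : 0 < y := by positivity
  have h2 : B * x' / h r' ≤ y := by
    rw [hy, div_le_div_iff₀ hhr' hhr]
    calc B * x' * h r ≤ B * (2 * x) * (8 ^ k * h r') := by gcongr; linarith
      _ = _ := by rw [hB₁]; ring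
  have hexp : x ≤ Real.exp x := by linarith [Real.add_one_le_exp x]
  have hyM : y ≤ K * Real.exp x := by
    calc y ≤ B₁ * Real.exp x / h (7 * δ) := by
          rw [hy]
          gcongr
          exact hmono (show 0 < 7 * δ by positivity) hr (by linarith)
      _ = K₁ * Real.exp x := by simp only [K₁]; ring
      _ ≤ _ := by gcongr; exact (le_max_left _ _).trans (le_max_right _ _)
  have hyM' : y⁻¹ ≤ K * Real.exp x := by
    have hpowx : x ^ k ≤ k.factorial * Real.exp x := by
      have := Real.pow_div_factorial_le_exp x hx0.le k
      rwa [div_le_iff₀ (by positivity), mul_comm] at this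
    calc y⁻¹ = h r / (B₁ * x) := by rw [hy, inv_div]
      _ ≤ 2 ^ k * (2 * x / (7 * δ)) ^ k * h (7 * δ) / (B₁ * (7 * δ)) := by
        gcongr
        exact (hmono hr (show 0 < 2 * x by linarith) hrx).trans
          (hgrow _ _ (by positivity) (by linarith))
      _ = 2 ^ k * (2 / (7 * δ)) ^ k * h (7 * δ) / (B₁ * (7 * δ)) * x ^ k := by
        rw [show 2 * x / (7 * δ) = 2 / (7 * δ) * x by ring, mul_pow]; ring
      _ ≤ 2 ^ k * (2 / (7 * δ)) ^ k * h (7 * δ) / (B₁ * (7 * δ)) *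
          (k.factorial * Real.exp x) := by gcongr
      _ = K₂ * Real.exp x := by simp only [K₂]; ring
      _ ≤ _ := by gcongr; exact (le_max_right _ _).trans (le_max_right _ _)
  have h3 : y ^ (β * (x' - x)) ≤ (K * Real.exp x) ^ (2 * β * δ) := by
    have hM1 : 1 ≤ K * Real.exp x := by
      have := Real.one_le_exp hx0.le
      nlinarith
    rcases le_total x x' with hxx | hxx
    · calc y ^ (β * (x' - x)) ≤ (K * Real.exp x) ^ (β * (x' - x)) := by
            apply Real.rpow_le_rpow hy0.le hyM
            exact mul_nonneg hβ.le (by linarith)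
        _ ≤ _ := by
            apply Real.rpow_le_rpow_of_exponent_le hM1
            nlinarith
    · calc y ^ (β * (x' - x)) = y⁻¹ ^ (β * (x - x')) := by
            rw [Real.inv_rpow hy0.le, ← Real.rpow_neg hy0.le]
            ring_nf
        _ ≤ (K * Real.exp x) ^ (β * (x - x')) := by
            apply Real.rpow_le_rpow (by positivity) hyM'
            exact mul_nonneg hβ.le (by linarith)
        _ ≤ _ := by
            apply Real.rpow_le_rpow_of_exponent_le hM1
            nlinarith
  calc (B * x' / h r') ^ (β * x') ≤ y ^ (β * x') := by gcongr
    _ = y ^ (β * (x' - x)) * y ^ (β * x) := by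
        rw [← Real.rpow_add hy0]; ring_nf
    _ ≤ (K * Real.exp x) ^ (2 * β * δ) * y ^ (β * x) := by gcongr
    _ = K ^ (2 * β * δ) * (Real.exp (2 * δ) ^ (β * x) * y ^ (β * x)) := by
        rw [Real.mul_rpow hK0.le (Real.exp_pos x).le, ← Real.exp_mul, ← Real.exp_mul]
        ring_nf
    _ = K ^ (2 * β * δ) * (B₁ * Real.exp (2 * δ) * x / h r) ^ (β * x) := by
        rw [← Real.mul_rpow (by positivity) hy0.le, hy]
        ring_nf

end Growth

/-! ### The vanishing theorem in the half-plane. -/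

variable {E : Type*} [NormedAddCommGroup E] [NormedSpace ℂ E]

theorem exists_factor_of_zeros [CompleteSpace E] {F : ℂ → E} {U : Set ℂ} (hU : IsOpen U)
    (hF : DifferentiableOn ℂ F U) {a : ℕ → ℂ} (ha : Function.Injective a) (haU : ∀ k, a k ∈ U)
    (hFa : ∀ k, F (a k) = 0) (n : ℕ) :
    ∃ Q : ℂ → E, DifferentiableOn ℂ Q U ∧
      ∀ z ∈ U, F z = (∏ k ∈ Finset.range n, (a k - z)) • Q z := by
  induction n with
  | zero => exact ⟨F, hF, by simp⟩
  | succ n ih =>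
    obtain ⟨Q, hQ, hFQ⟩ := ih
    have h0 : Q (a n) = 0 := by
      have h1 := hFQ _ (haU n)
      rw [hFa, eq_comm, smul_eq_zero, Finset.prod_eq_zero_iff] at h1
      refine h1.resolve_left ?_
      rintro ⟨k, hk, h2⟩
      have := ha (sub_eq_zero.1 h2)
      exact (Finset.mem_range.1 hk).ne this
    refine ⟨fun z => -dslope Q (a n) z,
      ((Complex.differentiableOn_dslope (hU.mem_nhds (haU n))).2 hQ).fun_neg, fun z hz => ?_⟩
    have h1 := sub_smul_dslope Q (a n) z
    rw [h0, sub_zero] at h1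
    rw [hFQ z hz, Finset.prod_range_succ, mul_smul, smul_neg, ← neg_smul, neg_sub, h1]

theorem blaschkeNorm_pos {a : ℕ → ℝ} (ha : ∀ k, 0 < a k) {n : ℕ} {z : ℂ} (hz : 0 < z.re)
    (hza : ∀ k < n, 0 < ‖(a k : ℂ) - z‖) : 0 < blaschkeNorm a n z := by
  refine Finset.prod_pos fun k hk => ?_
  have h1 := hza k (Finset.mem_range.1 hk)
  have h2 : 0 < ‖(a k : ℂ) + z‖ := by
    refine lt_of_lt_of_le ?_ ((le_abs_self _).trans (Complex.abs_re_le_norm _))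
    simp
    linarith [ha k]
  positivity

/-- Every factor `(a - x) / (a + x) * exp (2 x / a)` is at most one for `0 < x < a`. -/
theorem blaschkeNorm_le_one {a : ℕ → ℝ} {n : ℕ} {x : ℝ} (hx : 0 < x) (hxa : ∀ k, x < a k) :
    blaschkeNorm a n x ≤ 1 := by
  refine Finset.prod_le_one (fun k _ => by positivity) fun k _ => ?_
  have hk := hxa k
  rw [← Complex.ofReal_sub, ← Complex.ofReal_add, Complex.norm_real, Complex.norm_real,
    Complex.ofReal_re, Real.norm_of_nonneg (by linarith), Real.norm_of_nonneg (by linarith)]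
  set v := x / a k with hv
  have ha0 : 0 < a k := by linarith
  have hv0 : 0 < v := by positivity
  have hv1 : v < 1 := (div_lt_one ha0).2 hk
  have h1 : (a k - x) / (a k + x) = (1 - v) / (1 + v) := by rw [hv]; field_simp
  have h2 : 2 * x / a k = 2 * v := by rw [hv]; ring
  rw [h1, h2, div_mul_eq_mul_div, div_le_one (by linarith)]
  -- The series log((1+v)/(1-v)) = 2(v + v³/3 + ...) has nonnegative terms and hence dominates its
  -- first term 2v.
  have hsum := (Real.hasSum_log_sub_log_of_abs_lt_one (by rwa [abs_of_pos hv0])).summable.le_tsum 0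
    (fun i _ => by positivity)
  rw [(Real.hasSum_log_sub_log_of_abs_lt_one (by rwa [abs_of_pos hv0])).tsum_eq] at hsum
  norm_num at hsum
  have h3 : Real.exp (2 * v) ≤ (1 + v) / (1 - v) := by
    rw [← Real.log_le_log_iff (Real.exp_pos _) (div_pos (by linarith) (by linarith)), Real.log_exp,
      Real.log_div (by linarith) (by linarith)]
    linarith
  rw [le_div_iff₀ (by linarith)] at h3
  linarith

/-- A holomorphic function in the right half-plane, bounded by `φ(x)^x` and vanishing at the
exponents, is zero. -/
theorem eq_zero_of_isDivergentMinorant [CompleteSpace E] {a : ℕ → ℝ} (ha_pos : ∀ k, 0 < a k)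
    (ha_sep : ∃ d : ℝ, 0 < d ∧ ∀ k, d < a (k + 1) - a k) {φ : ℝ → ℝ} (hφ : ∀ x, 0 ≤ φ x)
    {h : ℝ → ℝ} (hh : IsDivergentMinorant φ a h) {F : ℂ → E}
    (hF : DifferentiableOn ℂ F {z | 0 < z.re}) (hFφ : ∀ z, 0 < z.re → ‖F z‖ ≤ φ z.re ^ z.re)
    (hFa : ∀ k, F (a k) = 0) : ∀ z, 0 < z.re → F z = 0 := by
  obtain ⟨hmono, ⟨C₀, D, -, hD0, hdoub⟩, hdiv, α, C, c, hα, hC, hc, hbound⟩ := hh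
  have hpos : ∀ r, 0 < r → 0 < h r := fun r hr => (hbound r r hr le_rfl).1
  obtain ⟨k, hgrow⟩ := exists_polynomial_growth hmono hpos (D := D) fun r hr => by
    have := (hdoub (2 * r) r (by positivity) hr (by field_simp; norm_num)
      (by field_simp; norm_num)).2
    rw [div_lt_iff₀ (hpos r hr)] at this
    exact this.le
  obtain ⟨d', hd', hsep'⟩ := ha_sep
  obtain ⟨d, hd, ha0, ha⟩ : ∃ d, 0 < d ∧ d ≤ a 0 ∧ ∀ k, d ≤ a (k + 1) - a k :=
    ⟨min d' (a 0), lt_min hd' (ha_pos 0), min_le_right _ _,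
      fun k => (min_le_left _ _).trans (hsep' k).le⟩
  have hre : ∀ ζ : ℂ, ζ.re ≤ ‖ζ‖ := fun ζ => (le_abs_self _).trans (Complex.abs_re_le_norm ζ)
  have hopen : IsOpen {z : ℂ | 0 < z.re} := isOpen_lt continuous_const Complex.continuous_re
  -- Exponents are at least 8δ apart and at least 8δ, so the δ-discs around them are far from each
  -- other and from the imaginary axis.
  set δ := d / 8 with hδ
  have hδ0 : 0 < δ := by positivity
  have hd8 : d = 8 * δ := by rw [hδ]; ring
  set β := α⁻¹ with hβ
  have hβ0 : 0 < β := by positivity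
  set κ := 2 / a 0 + 36 / d + 80 / δ with hκ
  set B₀ := c * Real.exp (κ / β) with hB₀
  have hB₀0 : 0 < B₀ := by positivity
  obtain ⟨A', B, hA', hBB, htrans⟩ := exists_rpow_le_rpow_of_near hmono hpos hgrow hβ0 hB₀0 hδ0
  have hB0 : 0 < B := by linarith
  set A := C ^ β * A' with hA
  have hA0 : 0 ≤ A := by positivity
  obtain ⟨b, hb, hhb⟩ := exists_tendsto_one_bound hpos hgrow hβ0 hB0
  have hφpow : ∀ z : ℂ, 0 < z.re →
      φ z.re ^ z.re ≤ C ^ β * (c * z.re / h ‖z‖) ^ (β * z.re) * Real.exp (2 * z.re * m a ‖z‖) := by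
    intro z hz
    obtain ⟨h1, h2⟩ := hbound z.re ‖z‖ hz (hre z)
    -- If this power were 0, division by zero would make the upper bound for h equal to 0, against h
    -- > 0.
    have hφ0 : 0 < φ z.re ^ α := by
      rcases (Real.rpow_nonneg (hφ z.re) α).eq_or_lt with h0 | h0
      · rw [← h0] at h2
        simp at h2
        linarith
      · exact h0
    have h3 : φ z.re ^ α ≤ C ^ (1 / z.re) * (c * z.re / h ‖z‖) * Psi a ‖z‖ ^ α := by
      rw [mul_div_assoc', div_mul_eq_mul_div, le_div_iff₀ hφ0, mul_comm (h _)] at h2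
      rw [mul_div_assoc', div_mul_eq_mul_div, le_div_iff₀ h1]
      linarith
    have h4 : φ z.re ^ z.re = (φ z.re ^ α) ^ (β * z.re) := by
      rw [← Real.rpow_mul (hφ _), hβ]
      congr 1
      field_simp
    rw [h4]
    refine (Real.rpow_le_rpow hφ0.le h3 (by positivity)).trans (le_of_eq ?_)
    rw [Real.mul_rpow (by positivity) (by unfold Psi; positivity),
      Real.mul_rpow (by positivity) (by positivity), ← Real.rpow_mul hC.le, Psi, ← Real.exp_mul,
      ← Real.exp_mul]
    congr 2
    · congr 1
      field_simp
    · rw [hβ]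
      field_simp
  have hinj : Function.Injective fun k => (a k : ℂ) :=
    Complex.ofReal_injective.comp (strictMono_of_separated hd ha).injective
  have key : ∀ N : ℕ, 0 < N → ∀ x : ℝ, 0 < x → x < 1 → x < a 0 →
      ‖F x‖ ≤ A * ((384 * Real.pi * B)⁻¹ * ∑ n ∈ Finset.range N, h (8 ^ n) / 8 ^ n) ^ (-(β * x)) := by
    intro N hN x hx hx1 hxa
    -- The margin `d` keeps the circles around zeros met in |z| ≤ 8^N inside |ζ| ≤ a_n, the range of
    -- `exp_mul_m_le`.
    obtain ⟨n, hn⟩ := exists_le_of_separated hd ha0 ha (8 ^ N + d)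
    obtain ⟨Q, hQ, hFQ⟩ := exists_factor_of_zeros hopen hF hinj (fun k => by simpa using ha_pos k)
      hFa n
    set H : ℂ → E := fun z =>
      (∏ k ∈ Finset.range n, ((a k + z) * Complex.exp (-(2 * z / a k)))) • Q z with hH
    have hHd : DifferentiableOn ℂ H {z | 0 < z.re} := by
      refine DifferentiableOn.smul ?_ hQ
      exact DifferentiableOn.fun_finsetProd fun k _ => by fun_prop
    have hFH : ∀ z : ℂ, 0 < z.re → ‖F z‖ = blaschkeNorm a n z * ‖H z‖ := by
      intro z hz
      rw [hFQ z hz, hH, norm_smul, norm_smul, ← mul_assoc, norm_prod, norm_prod, blaschkeNorm,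
        ← Finset.prod_mul_distrib]
      congr 1
      refine Finset.prod_congr rfl fun k _ => ?_
      have h2 : 0 < ‖(a k : ℂ) + z‖ := by
        refine lt_of_lt_of_le ?_ (hre _)
        simp
        linarith [ha_pos k]
      rw [norm_mul, Complex.norm_exp]
      have h3 : (-(2 * z / a k)).re = -(2 * z.re / a k) := by
        rw [Complex.neg_re, Complex.div_ofReal_re]
        simp
      rw [h3, Real.exp_neg]
      field_simp
    have hgood : ∀ z : ℂ, 0 < z.re → ‖z‖ ≤ a n → (∀ k < n, δ ≤ ‖(a k : ℂ) - z‖) →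
        ‖H z‖ ≤ C ^ β * (B₀ * z.re / h ‖z‖) ^ (β * z.re) := by
      intro z hz hzn hza
      have hbn := blaschkeNorm_pos ha_pos hz fun k hk => hδ0.trans_le (hza k hk)
      have h1 := exp_mul_m_le hd ha0 ha hδ0 (by linarith) hz hzn hza
      have h2 := hpos ‖z‖ (hz.trans_le (hre z))
      rw [← mul_le_mul_iff_right₀ hbn, ← hFH z hz]
      calc ‖F z‖ ≤ _ := (hFφ z hz).trans (hφpow z hz)
        _ ≤ C ^ β * (c * z.re / h ‖z‖) ^ (β * z.re) *
            (Real.exp (κ * z.re) * blaschkeNorm a n z) := by gcongr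
        _ = _ := by
          have h3 : B₀ * z.re / h ‖z‖ = c * z.re / h ‖z‖ * Real.exp (κ / β) := by
            rw [hB₀]; ring
          rw [h3, Real.mul_rpow (by positivity) (Real.exp_pos _).le, ← Real.exp_mul]
          have h4 : κ / β * (β * z.re) = κ * z.re := by field_simp
          rw [h4]
          ring
    have hall : ∀ z : ℂ, 0 < z.re → ‖z‖ ≤ 8 ^ N →
        ‖H z‖ ≤ A * (B * z.re / h ‖z‖) ^ (β * z.re) := by
      intro z hz hzN
      have hz' := hz.trans_le (hre z)
      have hhz := hpos ‖z‖ hz'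
      by_cases hfar : ∀ k < n, δ ≤ ‖(a k : ℂ) - z‖
      · refine (hgood z hz (by linarith) hfar).trans ?_
        rw [hA]
        have : C ^ β ≤ C ^ β * A' := le_mul_of_one_le_right (by positivity) hA'
        gcongr
      push Not at hfar
      -- Within δ of a zero, H is bounded by its maximum on the circle of radius δ about that zero.
      -- The circle keeps distance δ from every zero, so `hgood` applies on it, and `htrans` returns
      -- the bound to z.
      obtain ⟨j, hj, hzj⟩ := hfar
      have haj : 8 * δ ≤ a j := by
        have h1 := succ_mul_le_of_separated ha0 ha j
        rw [hd8] at h1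
        have : 0 ≤ (j : ℝ) * (8 * δ) := by positivity
        linarith
      have hball : Metric.closedBall (a j : ℂ) δ ⊆ {z | 0 < z.re} := by
        intro ζ hζ
        have h1 : ‖ζ - a j‖ ≤ δ := by simpa [dist_eq_norm] using hζ
        have h2 := (Complex.abs_re_le_norm _).trans h1
        simp at h2
        have := (abs_le.1 h2).1
        simp only [mem_ofPred_eq]
        linarith
      have hx1 : |z.re - a j| < δ := by
        have := Complex.abs_re_le_norm ((a j : ℂ) - z)
        simp at this
        rw [abs_sub_comm]
        linarith
      have hy1 : |z.im| < δ := by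
        have := Complex.abs_im_le_norm ((a j : ℂ) - z)
        simp at this
        linarith
      have hz7 : 7 * δ ≤ z.re := by linarith [(abs_lt.1 hx1).1]
      refine Complex.norm_le_of_forall_mem_frontier_norm_le (U := Metric.ball (a j : ℂ) δ)
        Metric.isBounded_ball ?_ ?_ (subset_closure ?_)
      · refine DifferentiableOn.diffContOnCl (hHd.mono ?_)
        exact Metric.closure_ball_subset_closedBall.trans hball
      · intro ζ hζ
        rw [frontier_ball _ hδ0.ne', mem_sphere_iff_norm] at hζ
        have hζ0 : 0 < ζ.re := hball (by rw [mem_closedBall_iff_norm, hζ])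
        have hζx : |ζ.re - a j| ≤ δ := by
          have := Complex.abs_re_le_norm (ζ - a j)
          simp at this
          linarith
        have hζz : ‖ζ‖ ≤ ‖z‖ + 2 * δ := by
          calc ‖ζ‖ = ‖(ζ - a j) + (a j - z) + z‖ := by congr 1; ring
            _ ≤ ‖ζ - a j‖ + ‖a j - z‖ + ‖z‖ := norm_add₃_le
            _ ≤ _ := by linarith
        refine (hgood ζ hζ0 (by linarith) ?_).trans ?_
        · intro i hi
          by_cases hij : i = j
          · rw [hij, norm_sub_rev, hζ]
          · have h1 : 8 * δ ≤ |a i - a j| := by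
              rcases lt_or_gt_of_ne hij with h | h
              · have h2 := sub_le_of_separated ha h.le
                have h3 : (1 : ℝ) ≤ (j - i : ℕ) := by
                  exact_mod_cast (show 1 ≤ j - i by omega)
                rw [abs_sub_comm]
                refine le_trans ?_ (le_abs_self _)
                nlinarith
              · have h2 := sub_le_of_separated ha h.le
                have h3 : (1 : ℝ) ≤ (i - j : ℕ) := by
                  exact_mod_cast (show 1 ≤ i - j by omega)
                refine le_trans ?_ (le_abs_self _)
                nlinarith
            have h2 : ‖(a i : ℂ) - a j‖ ≤ ‖(a i : ℂ) - ζ‖ + ‖ζ - a j‖ :=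
              norm_sub_le_norm_sub_add_norm_sub _ _ _
            rw [← Complex.ofReal_sub, Complex.norm_real, Real.norm_eq_abs, hζ] at h2
            linarith
        · have h1 : |ζ.re - z.re| ≤ 2 * δ := by
            calc |ζ.re - z.re| ≤ |ζ.re - a j| + |a j - z.re| := abs_sub_le _ _ _
              _ ≤ _ := by rw [abs_sub_comm (a j)]; linarith
          have h2 : ‖z‖ ≤ 2 * z.re := by
            calc ‖z‖ ≤ |z.re| + |z.im| := Complex.norm_le_abs_re_add_abs_im z
              _ ≤ _ := by rw [abs_of_pos hz]; linarith
          have h3 := htrans _ _ _ _ hz7 h1 (hre ζ) (hre z) h2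
          calc _ ≤ C ^ β * (A' * (B * z.re / h ‖z‖) ^ (β * z.re)) :=
                mul_le_mul_of_nonneg_left h3 (by positivity)
            _ = _ := (mul_assoc _ _ _).symm
      · rw [Metric.mem_ball, dist_eq_norm, norm_sub_rev]
        exact hzj
    have hx0 : 0 < ((x : ℂ)).re := by simpa using hx
    rw [hFH x hx0]
    have hmon := (strictMono_of_separated hd ha).monotone
    calc _ ≤ 1 * ‖H x‖ := by
          gcongr
          exact blaschkeNorm_le_one hx fun k => hxa.trans_le (hmon (Nat.zero_le k))
      _ = ‖H x‖ := one_mul _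
      _ ≤ _ := by
          have := norm_le_unit_half_disc hHd hβ0 hB0 hA0 hmono hpos hb hhb N hall hN hx0
            (by rw [Complex.norm_real, Real.norm_of_nonneg hx.le]; exact hx1.le)
          simpa using this
  have hzero : ∀ x : ℝ, 0 < x → x < 1 → x < a 0 → F x = 0 := by
    intro x hx hx1 hxa
    rw [← norm_le_zero_iff]
    have hlim : Tendsto (fun N : ℕ => A * ((384 * Real.pi * B)⁻¹ *
        ∑ n ∈ Finset.range N, h (8 ^ n) / 8 ^ n) ^ (-(β * x))) atTop (𝓝 (A * 0)) := by
      refine Tendsto.const_mul _ ((tendsto_rpow_neg_atTop (by positivity)).comp ?_)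
      exact (tendsto_sum_dyadic hmono hpos hdiv).const_mul_atTop (by positivity)
    rw [mul_zero] at hlim
    refine ge_of_tendsto hlim ?_
    filter_upwards [eventually_gt_atTop 0] with N hN
    exact key N hN x hx hx1 hxa
  set x₀ := min 1 (a 0) / 2 with hx₀
  have hm0 : 0 < min 1 (a 0) := lt_min one_pos (ha_pos 0)
  have hx₀0 : 0 < x₀ := by positivity
  have hfreq : ∃ᶠ z in 𝓝[≠] (x₀ : ℂ), F z = 0 := by
    have h1 : Tendsto (fun x : ℝ => (x : ℂ)) (𝓝[≠] x₀) (𝓝[≠] (x₀ : ℂ)) :=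
      tendsto_nhdsWithin_of_tendsto_nhds_of_eventually_within _
        (Complex.continuous_ofReal.continuousAt.tendsto.mono_left nhdsWithin_le_nhds) (by
          filter_upwards [self_mem_nhdsWithin] with x hx
          simpa using hx)
    refine h1.frequently (Eventually.frequently ?_)
    refine nhdsWithin_le_nhds ?_
    have hlt : x₀ < min 1 (a 0) := by rw [hx₀]; linarith
    filter_upwards [Ioo_mem_nhds hx₀0 hlt] with x hx
    exact hzero x hx.1 (hx.2.trans_le (min_le_left _ _)) (hx.2.trans_le (min_le_right _ _))
  exact fun z hz => (hF.analyticOnNhd hopen).eqOn_zero_of_preconnected_of_frequently_eq_zero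
    (convex_halfSpace_re_gt 0).isPreconnected (by simpa using hx₀0) hfreq hz

end Muntz

/-! ### Powers as a holomorphic family and approximation of compactly supported functions. -/

namespace Muntz

theorem rpow_le_rpow_add_rpow {t p q y : ℝ} (ht : 0 < t) (hp : p ≤ y) (hq : y ≤ q) :
    t ^ y ≤ t ^ p + t ^ q := by
  have h1 : 0 < t ^ p := Real.rpow_pos_of_pos ht p
  have h2 : 0 < t ^ q := Real.rpow_pos_of_pos ht q
  rcases le_total t 1 with h | h
  · linarith [Real.rpow_le_rpow_of_exponent_ge ht h hp]
  · linarith [Real.rpow_le_rpow_of_exponent_le h hq]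

theorem rpow_add_rpow_inv_le {t ε ε' : ℝ} (ht : 0 < t) (hε' : 0 < ε') (hεε' : ε' ≤ ε)
    (hε : ε ≤ 1) : t ^ ε + t ^ ε⁻¹ ≤ 2 * (t ^ ε' + t ^ ε'⁻¹) := by
  have h0 : 0 < ε := hε'.trans_le hεε'
  have h1 : ε⁻¹ ≤ ε'⁻¹ := by gcongr
  have h2 : 1 ≤ ε⁻¹ := (one_le_inv₀ h0).2 hε
  have := rpow_le_rpow_add_rpow ht hεε' (show ε ≤ ε'⁻¹ by linarith)
  have := rpow_le_rpow_add_rpow ht (show ε' ≤ ε⁻¹ by linarith) h1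
  linarith

/-- The functions continuous on `(0,∞)` and dominated by positive powers. -/
def powerDominated : Submodule ℂ (ℝ → ℂ) where
  carrier := {u | ContinuousOn u (Ioi 0) ∧ ∃ ε C : ℝ, 0 < ε ∧ ε ≤ 1 ∧ 0 ≤ C ∧
    ∀ t, 0 < t → ‖u t‖ ≤ C * (t ^ ε + t ^ ε⁻¹)}
  zero_mem' := ⟨continuousOn_const, 1, 0, one_pos, le_rfl, le_rfl, by simp⟩
  add_mem' := by
    rintro u v ⟨hu, ε, C, hε, hε1, hC, h⟩ ⟨hv, ε', C', hε', hε1', hC', h'⟩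
    refine ⟨hu.add hv, min ε ε', 2 * C + 2 * C', lt_min hε hε', (min_le_left _ _).trans hε1,
      by positivity, fun t ht => (norm_add_le _ _).trans ?_⟩
    have h1 := rpow_add_rpow_inv_le ht (lt_min hε hε') (min_le_left _ _) hε1
    have h2 := rpow_add_rpow_inv_le ht (lt_min hε hε') (min_le_right _ _) hε1'
    have h3 := mul_le_mul_of_nonneg_left h1 hC
    have h4 := mul_le_mul_of_nonneg_left h2 hC'
    linarith [h t ht, h' t ht]
  smul_mem' := by
    rintro c u ⟨hu, ε, C, hε, hε1, hC, h⟩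
    refine ⟨hu.const_smul c, ε, ‖c‖ * C, hε, hε1, by positivity, fun t ht => ?_⟩
    rw [Pi.smul_apply, norm_smul, mul_assoc]
    gcongr
    exact h t ht

theorem mem_powerDominated {u : ℝ → ℂ} (hu : ContinuousOn u (Ioi 0)) {p q C : ℝ} (hp : 0 < p)
    (hq : 0 < q) (hC : 0 ≤ C) (h : ∀ t, 0 < t → ‖u t‖ ≤ C * (t ^ p + t ^ q)) :
    u ∈ powerDominated := by
  set ε := min 1 (min (min p p⁻¹) (min q q⁻¹)) with hε
  have hε0 : 0 < ε := by positivity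
  have key : ∀ y : ℝ, 0 < y → ε ≤ y → ε ≤ y⁻¹ → ∀ t : ℝ, 0 < t → t ^ y ≤ t ^ ε + t ^ ε⁻¹ :=
    fun y hy h1 h2 t ht => rpow_le_rpow_add_rpow ht h1 ((le_inv_comm₀ hε0 hy).1 h2)
  refine ⟨hu, ε, C * 2, hε0, min_le_left _ _, by positivity, fun t ht => (h t ht).trans ?_⟩
  have h1 := key p hp (by simp [hε]) (by simp [hε]) t ht
  have h2 := key q hq (by simp [hε]) (by simp [hε]) t ht
  rw [mul_assoc]
  gcongr
  linarith

theorem continuousOn_cpow_const (z : ℂ) : ContinuousOn (fun t : ℝ => (t : ℂ) ^ z) (Ioi 0) := by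
  exact fun t ht =>
    (Complex.continuousAt_ofReal_cpow_const t z (Or.inr (ne_of_gt ht))).continuousWithinAt

theorem norm_cpow {t : ℝ} (ht : 0 < t) (z : ℂ) : ‖(t : ℂ) ^ z‖ = t ^ z.re :=
  Complex.norm_cpow_eq_rpow_re_of_pos ht z

open Classical in
/-- The power `t ↦ t ^ z`, for `0 < re z`, as an element of `powerDominated`. -/
noncomputable def powerElt (z : ℂ) : powerDominated :=
  if hz : 0 < z.re then ⟨fun t => (t : ℂ) ^ z, mem_powerDominated (continuousOn_cpow_const z) hz hz
    zero_le_one fun t ht => by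
      have := Real.rpow_pos_of_pos ht z.re
      rw [norm_cpow ht]
      linarith⟩
  else 0

theorem powerElt_apply {z : ℂ} (hz : 0 < z.re) (t : ℝ) : (powerElt z : ℝ → ℂ) t = (t : ℂ) ^ z := by
  rw [powerElt, dif_pos hz]

theorem exp_mul_abs_log_le {t : ℝ} (ht : 0 < t) (y : ℝ) :
    Real.exp (y * |Real.log t|) ≤ t ^ (-y) + t ^ y := by
  have h1 := Real.rpow_pos_of_pos ht y
  have h2 := Real.rpow_pos_of_pos ht (-y)
  rcases abs_choice (Real.log t) with h | h <;> rw [h]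
  · have : t ^ y = Real.exp (y * Real.log t) := by rw [Real.rpow_def_of_pos ht, mul_comm]
    linarith
  · have : t ^ (-y) = Real.exp (y * -Real.log t) := by rw [Real.rpow_def_of_pos ht]; ring_nf
    linarith

theorem log_mul_cpow_mem {z : ℂ} (hz : 0 < z.re) :
    (fun t : ℝ => (Real.log t : ℂ) * (t : ℂ) ^ z) ∈ powerDominated := by
  set ρ := z.re / 2 with hρ
  have hρ0 : 0 < ρ := by positivity
  refine mem_powerDominated ?_ (p := z.re - ρ) (q := z.re + ρ) (C := ρ⁻¹) (by rw [hρ]; linarith)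
    (by positivity) (by positivity) fun t ht => ?_
  · refine ContinuousOn.mul ?_ (continuousOn_cpow_const z)
    refine Complex.continuous_ofReal.comp_continuousOn ?_
    exact Real.continuousOn_log.mono fun t ht => (ne_of_gt ht)
  · rw [norm_mul, norm_cpow ht, Complex.norm_real, Real.norm_eq_abs]
    have h1 : ρ * |Real.log t| ≤ t ^ (-ρ) + t ^ ρ :=
      le_trans (by linarith [Real.add_one_le_exp (ρ * |Real.log t|)]) (exp_mul_abs_log_le ht ρ)
    have h2 := Real.rpow_pos_of_pos ht z.re
    rw [sub_eq_add_neg, Real.rpow_add ht, Real.rpow_add ht, inv_mul_eq_div, le_div_iff₀ hρ0]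
    nlinarith

section Embedding

variable {X : Type*} [NormedAddCommGroup X] [NormedSpace ℂ X] (J : powerDominated →ₗ[ℂ] X)

/-- With w = (z - z₀) log t the remainder is t^{z₀}(e^w - 1 - w), of modulus at most t^x |w|²
e^{|w|}. This is pointwise at most a multiple of |z - z₀|² (t^{x-2ρ} + t^{x+2ρ}), and the
monotonicity `hJ` turns it into a norm bound. -/
theorem hasDerivAt_powerElt
    (hJ : ∀ u v : powerDominated,
      (∀ t, 0 < t → ‖(u : ℝ → ℂ) t‖ ≤ ‖(v : ℝ → ℂ) t‖) → ‖J u‖ ≤ ‖J v‖)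
    {z₀ : ℂ} (hz₀ : 0 < z₀.re) :
    HasDerivAt (fun z => J (powerElt z)) (J ⟨_, log_mul_cpow_mem hz₀⟩) z₀ := by
  set x := z₀.re with hx
  set ρ := x / 4 with hρ
  have hρ0 : 0 < ρ := by positivity
  have hr1 : 0 < ((x - 2 * ρ : ℝ) : ℂ).re := by rw [Complex.ofReal_re, hρ]; linarith
  have hr2 : 0 < ((x + 2 * ρ : ℝ) : ℂ).re := by rw [Complex.ofReal_re]; positivity
  set v : powerDominated := powerElt (x - 2 * ρ : ℝ) + powerElt (x + 2 * ρ : ℝ) with hv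
  have hvt : ∀ t, 0 < t → (v : ℝ → ℂ) t = (t ^ (x - 2 * ρ) + t ^ (x + 2 * ρ) : ℝ) := by
    intro t ht
    rw [hv, Submodule.coe_add, Pi.add_apply, powerElt_apply hr1, powerElt_apply hr2,
      Complex.ofReal_add (t ^ _), Complex.ofReal_cpow ht.le, Complex.ofReal_cpow ht.le]
  rw [hasDerivAt_iff_isLittleO]
  refine Asymptotics.IsBigO.trans_isLittleO (g := fun z => ‖z - z₀‖ ^ 2) ?_
    (Asymptotics.isLittleO_pow_sub_sub z₀ one_lt_two)
  refine Asymptotics.IsBigO.of_bound (2 / ρ ^ 2 * ‖J v‖) ?_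
  filter_upwards [Metric.ball_mem_nhds z₀ hρ0] with z hz
  rw [mem_ball_iff_norm] at hz
  have hzre : 0 < z.re := by
    have h1 := (abs_le.1 (Complex.abs_re_le_norm (z - z₀))).1
    simp at h1
    linarith
  rw [← map_smul, ← map_sub, ← map_sub, Real.norm_of_nonneg (by positivity)]
  set c : ℝ := 2 / ρ ^ 2 * ‖z - z₀‖ ^ 2 with hc
  have hc0 : 0 ≤ c := by positivity
  calc _ ≤ ‖J ((c : ℂ) • v)‖ := hJ _ _ fun t ht => ?_
    _ = c * ‖J v‖ := by rw [map_smul, norm_smul, Complex.norm_real, Real.norm_of_nonneg hc0]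
    _ = _ := by rw [hc]; ring
  have ht' : (t : ℂ) ≠ 0 := by exact_mod_cast ht.ne'
  simp only [Submodule.coe_sub, Submodule.coe_smul, Pi.sub_apply, Pi.smul_apply,
    powerElt_apply hzre, powerElt_apply hz₀, smul_eq_mul, hvt t ht]
  set w : ℂ := (z - z₀) * (Real.log t : ℂ) with hw
  have h1 : (t : ℂ) ^ z = (t : ℂ) ^ z₀ * Complex.exp w := by
    have : (t : ℂ) ^ (z - z₀) = Complex.exp w := by
      rw [Complex.cpow_def_of_ne_zero ht', hw, Complex.ofReal_log ht.le, mul_comm]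
    rw [← this, ← Complex.cpow_add _ _ ht']
    congr 1
    ring
  have h2 : (t : ℂ) ^ z - (t : ℂ) ^ z₀ - (z - z₀) * ((Real.log t : ℂ) * (t : ℂ) ^ z₀) =
      (t : ℂ) ^ z₀ * (Complex.exp w - ∑ m ∈ Finset.range 2, w ^ m / m.factorial) := by
    rw [h1, Finset.sum_range_succ, Finset.sum_range_one, hw]
    simp
    ring
  rw [h2, norm_mul, norm_mul, norm_cpow ht, Complex.norm_real, Complex.norm_real,
    Real.norm_of_nonneg hc0, Real.norm_of_nonneg (by positivity)]
  have hwn : ‖w‖ = ‖z - z₀‖ * |Real.log t| := by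
    rw [hw, norm_mul, Complex.norm_real, Real.norm_eq_abs]
  set l := |Real.log t| with hl
  have hl0 : 0 ≤ l := abs_nonneg _
  -- One factor e^{ρl} bounds e^{|w|} and the other absorbs l².
  have h3 : ‖w‖ ^ 2 * Real.exp ‖w‖ ≤ c * Real.exp (2 * ρ * l) := by
    have h4 : l ^ 2 ≤ 2 / ρ ^ 2 * Real.exp (ρ * l) := by
      have := Real.quadratic_le_exp_of_nonneg (show 0 ≤ ρ * l by positivity)
      rw [div_mul_eq_mul_div, le_div_iff₀ (by positivity)]
      nlinarith [mul_nonneg hρ0.le hl0]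
    calc ‖w‖ ^ 2 * Real.exp ‖w‖ ≤ ‖z - z₀‖ ^ 2 * (2 / ρ ^ 2 * Real.exp (ρ * l)) *
          Real.exp (ρ * l) := by
          rw [hwn, mul_pow]
          gcongr
      _ = c * (Real.exp (ρ * l) * Real.exp (ρ * l)) := by rw [hc]; ring
      _ = _ := by rw [← Real.exp_add]; ring_nf
  calc _ ≤ t ^ x * (‖w‖ ^ 2 * Real.exp ‖w‖) := by
        gcongr
        exact Complex.norm_exp_sub_sum_le_norm_mul_exp w 2
    _ ≤ t ^ x * (c * (t ^ (-(2 * ρ)) + t ^ (2 * ρ))) := by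
        refine mul_le_mul_of_nonneg_left (h3.trans ?_) (by positivity)
        exact mul_le_mul_of_nonneg_left (exp_mul_abs_log_le ht _) hc0
    _ = _ := by
        rw [sub_eq_add_neg, Real.rpow_add ht, Real.rpow_add ht]
        ring

theorem powerElt_mem_closure_span [CompleteSpace X]
    (hJ : ∀ u v : powerDominated,
      (∀ t, 0 < t → ‖(u : ℝ → ℂ) t‖ ≤ ‖(v : ℝ → ℂ) t‖) → ‖J u‖ ≤ ‖J v‖)
    {a : ℕ → ℝ} (ha_pos : ∀ k, 0 < a k)
    (ha_sep : ∃ d : ℝ, 0 < d ∧ ∀ k, d < a (k + 1) - a k) {φ : ℝ → ℝ} (hφ : ∀ x, 0 ≤ φ x)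
    {h : ℝ → ℝ} (hh : IsDivergentMinorant φ a h)
    (hφJ : ∀ z, 0 < z.re → ‖J (powerElt z)‖ ≤ φ z.re ^ z.re) {z : ℂ} (hz : 0 < z.re) :
    J (powerElt z) ∈
      (Submodule.span ℂ (range fun k => J (powerElt (a k)))).topologicalClosure := by
  set M := (Submodule.span ℂ (range fun k => J (powerElt (a k)))).topologicalClosure
  have : IsClosed (M : Set X) := Submodule.isClosed_topologicalClosure _
  have hmem : ∀ x : X, M.mkQL x = 0 ↔ x ∈ M := fun x => by
    rw [Submodule.mkQL_apply, Submodule.mkQ_apply, Submodule.Quotient.mk_eq_zero]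
  rw [← hmem]
  refine eq_zero_of_isDivergentMinorant ha_pos ha_sep hφ hh
    (F := fun z => M.mkQL (J (powerElt z))) ?_ ?_ ?_ z hz
  · intro z hz
    exact (M.mkQL.differentiableAt.comp z
      (hasDerivAt_powerElt J hJ hz).differentiableAt).differentiableWithinAt
  · intro z hz
    exact (Submodule.Quotient.norm_mk_le M _).trans (hφJ z hz)
  · intro k
    rw [hmem]
    exact Submodule.le_topologicalClosure _ (Submodule.subset_span ⟨k, rfl⟩)

/-- The functions with compact support in `(0,∞)` are limits of combinations of powers. -/
theorem compactSupport_mem_of_powerElt_mem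
    (hJ : ∀ u v : powerDominated,
      (∀ t, 0 < t → ‖(u : ℝ → ℂ) t‖ ≤ ‖(v : ℝ → ℂ) t‖) → ‖J u‖ ≤ ‖J v‖)
    {M : Submodule ℂ X} (hM : IsClosed (M : Set X))
    (hpow : ∀ z : ℂ, 0 < z.re → J (powerElt z) ∈ M) (u : powerDominated) {L₀ K : ℝ}
    (hsupp : ∀ t, 0 < t → L₀ ≤ |Real.log t| → (u : ℝ → ℂ) t = 0)
    (hK : ∀ t, 0 < t → ‖(u : ℝ → ℂ) t‖ ≤ K * t) : J u ∈ M := by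
  have hK0 : 0 ≤ K := by simpa using (norm_nonneg _).trans (hK 1 one_pos)
  have hre1 : 0 < ((1 : ℝ) : ℂ).re := by simp
  have hre2 : 0 < ((2 : ℝ) : ℂ).re := by simp
  have hreh : 0 < ((1 / 2 : ℝ) : ℂ).re := by rw [Complex.ofReal_re]; norm_num
  have hofReal : ∀ {x : ℝ} (hx : 0 < (x : ℂ).re) {t : ℝ} (ht : 0 < t),
      (powerElt (x : ℂ) : ℝ → ℂ) t = (t ^ x : ℝ) := fun {x} hx {t} ht => by
    rw [powerElt_apply hx, Complex.ofReal_cpow ht.le]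
  set N := ‖J (powerElt (1 : ℝ))‖ +
    (K + 1) * ‖J (powerElt (2 : ℝ) + powerElt (1 / 2 : ℝ))‖ with hN
  -- The constant `N` does not depend on ε, although the period and the trigonometric polynomial do.
  have key : ∀ ε : ℝ, 0 < ε → ε ≤ 1 → ∃ P : powerDominated, J P ∈ M ∧ ‖J u - J P‖ ≤ ε * N := by
    intro ε hε hε1
    set L := max (max L₀ 1) (-2 * Real.log ε) with hL
    have hLL₀ : L₀ ≤ L := (le_max_left _ _).trans (le_max_left _ _)
    have hL1 : 1 ≤ L := (le_max_right _ _).trans (le_max_left _ _)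
    have hLε : Real.exp (-(L / 2)) ≤ ε := by
      rw [← Real.le_log_iff_exp_le hε]
      linarith [le_max_right (max L₀ 1) (-2 * Real.log ε)]
    set T := 2 * L with hT
    have : Fact (0 < T) := ⟨by positivity⟩
    -- Removing a factor t makes the approximants t·e^{2πin(log t)/T} = t^{1+2πin/T}, whose
    -- exponents have positive real part.
    set v : ℝ → ℂ := fun s => (u : ℝ → ℂ) (Real.exp s) * (Real.exp (-s) : ℝ) with hv
    have hvc : Continuous v := by
      refine Continuous.mul ?_ (by fun_prop)
      exact u.2.1.comp_continuous Real.continuous_exp fun s => Real.exp_pos s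
    have hv0 : ∀ s, L ≤ |s| → v s = 0 := by
      intro s hs
      rw [hv]
      simp only
      rw [hsupp _ (Real.exp_pos s) (by rw [Real.log_exp]; linarith), zero_mul]
    have hvK : ∀ s, ‖v s‖ ≤ K := by
      intro s
      rw [hv, norm_mul, Complex.norm_real, Real.norm_of_nonneg (Real.exp_pos _).le]
      calc _ ≤ K * Real.exp s * Real.exp (-s) := by gcongr; exact hK _ (Real.exp_pos s)
        _ = K := by rw [mul_assoc, ← Real.exp_add]; simp
    have hper : v (-L) = v (-L + T) := by
      rw [hv0 _ (by rw [abs_neg]; exact le_abs_self L), hv0 _ (by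
        rw [hT]; ring_nf; exact le_abs_self L)]
    set f : C(AddCircle T, ℂ) := ⟨AddCircle.liftIco T (-L) v,
      AddCircle.liftIco_continuous hper hvc.continuousOn⟩ with hf
    have hfv : ∀ s : ℝ, s ∈ Ico (-L) (-L + T) → f s = v s := fun s hs => by
      change AddCircle.liftIco T (-L) v s = v s
      exact AddCircle.liftIco_coe_apply hs
    have hfK : ‖f‖ ≤ K := by
      rw [ContinuousMap.norm_le _ hK0]
      intro s
      obtain ⟨s', hs', rfl⟩ : ∃ s' ∈ Ico (-L) (-L + T), (s' : AddCircle T) = s := by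
        have := AddCircle.coe_image_Ico_eq T (-L)
        exact (this ▸ mem_univ s : s ∈ _ '' _)
      rw [hfv s' hs']
      exact hvK s'
    have hfcl : f ∈ closure (Submodule.span ℂ (range (@fourier T)) : Set C(AddCircle T, ℂ)) := by
      rw [← Submodule.topologicalClosure_coe, span_fourier_closure_eq_top]
      trivial
    obtain ⟨g, hg, hfg⟩ := Metric.mem_closure_iff.1 hfcl ε hε
    rw [dist_eq_norm] at hfg
    have hP : ∃ P : powerDominated, J P ∈ M ∧
        ∀ t, 0 < t → (P : ℝ → ℂ) t = t * g (Real.log t : ℝ) := by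
      clear hfg
      induction hg using Submodule.span_induction with
      | mem g hg =>
        obtain ⟨n, rfl⟩ := hg
        have hn : 0 < (1 + 2 * Real.pi * Complex.I * n / T : ℂ).re := by
          rw [Complex.add_re, Complex.div_ofReal_re]
          simp
        refine ⟨powerElt _, hpow _ hn, fun t ht => ?_⟩
        have ht' : (t : ℂ) ≠ 0 := by exact_mod_cast ht.ne'
        rw [powerElt_apply hn, fourier_coe_apply, Complex.cpow_add _ _ ht', Complex.cpow_one,
          Complex.cpow_def_of_ne_zero ht', Complex.ofReal_log ht.le]
        congr 2
        ring
      | zero => exact ⟨0, by simp, by simp⟩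
      | add g₁ g₂ _ _ h₁ h₂ =>
        obtain ⟨P₁, hM₁, hP₁⟩ := h₁
        obtain ⟨P₂, hM₂, hP₂⟩ := h₂
        refine ⟨P₁ + P₂, by rw [map_add]; exact M.add_mem hM₁ hM₂, fun t ht => ?_⟩
        rw [Submodule.coe_add, Pi.add_apply, hP₁ t ht, hP₂ t ht, ContinuousMap.add_apply, mul_add]
      | smul c g _ h =>
        obtain ⟨P, hM, hP⟩ := h
        refine ⟨c • P, by rw [map_smul]; exact M.smul_mem c hM, fun t ht => ?_⟩
        rw [Submodule.coe_smul, Pi.smul_apply, hP t ht, ContinuousMap.smul_apply, smul_eq_mul,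
          smul_eq_mul]
        ring
    obtain ⟨P, hPM, hPt⟩ := hP
    refine ⟨P, hPM, ?_⟩
    -- A pointwise majorant of the error: εt for |log t| < L; beyond that u = 0 and the periodic
    -- approximant is at most (K + 1)t, which the second summand dominates.
    set c : powerDominated := (ε : ℂ) • powerElt (1 : ℝ) +
      ((ε * (K + 1) : ℝ) : ℂ) • (powerElt (2 : ℝ) + powerElt (1 / 2 : ℝ)) with hc
    have hct : ∀ t, 0 < t →
        ‖(c : ℝ → ℂ) t‖ = ε * t + ε * (K + 1) * (t ^ (2 : ℝ) + t ^ (1 / 2 : ℝ)) := by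
      intro t ht
      have : (c : ℝ → ℂ) t =
          (ε * t + ε * (K + 1) * (t ^ (2 : ℝ) + t ^ (1 / 2 : ℝ)) : ℝ) := by
        simp only [hc, Submodule.coe_add, Submodule.coe_smul, Pi.add_apply, Pi.smul_apply,
          hofReal hre1 ht, hofReal hre2 ht, hofReal hreh ht, smul_eq_mul, Real.rpow_one]
        push_cast
        ring
      rw [this, Complex.norm_real, Real.norm_of_nonneg (by positivity)]
    calc ‖J u - J P‖ = ‖J (u - P)‖ := by rw [map_sub]
      _ ≤ ‖J c‖ := hJ _ _ fun t ht => ?_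
      _ ≤ ε * N := by
        rw [hc, map_add, map_smul, map_smul]
        refine (norm_add_le _ _).trans (le_of_eq ?_)
        rw [norm_smul, norm_smul, Complex.norm_real, Complex.norm_real, Real.norm_of_nonneg hε.le,
          Real.norm_of_nonneg (by positivity), hN]
        ring
    rw [hct t ht, Submodule.coe_sub, Pi.sub_apply, hPt t ht]
    have h2 : 0 < t ^ (2 : ℝ) := Real.rpow_pos_of_pos ht _
    have hh : 0 < t ^ (1 / 2 : ℝ) := Real.rpow_pos_of_pos ht _
    rcases lt_or_ge |Real.log t| L with hlog | hlog
    · have hs : Real.log t ∈ Ico (-L) (-L + T) := by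
        have := abs_lt.1 hlog
        exact ⟨this.1.le, by linarith⟩
      have h3 : (u : ℝ → ℂ) t = t * f (Real.log t : ℝ) := by
        have ht' : (t : ℂ) ≠ 0 := by exact_mod_cast ht.ne'
        rw [hfv _ hs, hv]
        simp only
        rw [Real.exp_neg, Real.exp_log ht]
        push_cast
        field_simp
      have h4 : ‖(f - g) (Real.log t : ℝ)‖ ≤ ε := ((f - g).norm_coe_le_norm _).trans hfg.le
      rw [ContinuousMap.sub_apply] at h4
      rw [h3, ← mul_sub, norm_mul, Complex.norm_real, Real.norm_of_nonneg ht.le]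
      have : 0 ≤ ε * (K + 1) * (t ^ (2 : ℝ) + t ^ (1 / 2 : ℝ)) := by positivity
      nlinarith
    · rw [hsupp t ht (hLL₀.trans hlog), zero_sub, norm_neg, norm_mul, Complex.norm_real,
        Real.norm_of_nonneg ht.le]
      have h3 : ‖g (Real.log t : ℝ)‖ ≤ K + 1 := by
        calc ‖g (Real.log t : ℝ)‖ ≤ ‖g‖ := g.norm_coe_le_norm _
          _ = ‖f - (f - g)‖ := by congr 1; abel
          _ ≤ ‖f‖ + ‖f - g‖ := norm_sub_le _ _
          _ ≤ K + 1 := by linarith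
      -- The choice of L gives e^{-L/2} ≤ ε, so εt ≥ 1 for large t and √t ≤ ε for small t.
      have h4 : t ≤ ε * (t ^ (2 : ℝ) + t ^ (1 / 2 : ℝ)) := by
        rcases le_abs.1 hlog with h | h
        · have h5 : Real.exp (-(L / 2)) * t ≥ 1 := by
            have : Real.exp L ≤ t := (Real.le_log_iff_exp_le ht).1 h
            calc Real.exp (-(L / 2)) * t ≥ Real.exp (-(L / 2)) * Real.exp L := by gcongr
              _ = Real.exp (L / 2) := by rw [← Real.exp_add]; ring_nf
              _ ≥ 1 := Real.one_le_exp (by linarith)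
          have h6 : 1 ≤ ε * t := le_trans h5 (by gcongr)
          rw [Real.rpow_two]
          nlinarith
        · have h5 : t ^ (1 / 2 : ℝ) ≤ ε := by
            refine le_trans ?_ hLε
            rw [Real.rpow_def_of_pos ht, Real.exp_le_exp]
            linarith
          have h6 : t = t ^ (1 / 2 : ℝ) * t ^ (1 / 2 : ℝ) := by
            rw [← Real.rpow_add ht]; norm_num
          nlinarith
      have : 0 ≤ ε * t := by positivity
      calc t * ‖g (Real.log t : ℝ)‖ ≤ ε * (t ^ (2 : ℝ) + t ^ (1 / 2 : ℝ)) * (K + 1) := by gcongr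
        _ ≤ _ := by linarith
  have hcl : J u ∈ closure (M : Set X) := by
    rw [Metric.mem_closure_iff]
    intro η hη
    have hN0 : 0 ≤ N := by positivity
    obtain ⟨P, hPM, hP⟩ := key (min 1 (η / (N + 1))) (by positivity) (min_le_left _ _)
    refine ⟨J P, hPM, ?_⟩
    rw [dist_eq_norm]
    calc _ ≤ min 1 (η / (N + 1)) * N := hP
      _ ≤ η / (N + 1) * N := by gcongr; exact min_le_right _ _
      _ < η := by
        rw [div_mul_eq_mul_div, div_lt_iff₀ (by positivity)]
        nlinarith
  rwa [hM.closure_eq] at hcl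

end Embedding

end Muntz

/-! ### Passage to real and general scalars. -/

namespace Muntz

/-- Powers with real exponents are real-valued, so only coefficients split. The imaginary part is
carried along because multiplication by a complex scalar mixes the two. -/
theorem exists_real_parts {a : ℕ → ℝ} (ha_pos : ∀ k, 0 < a k) {P : powerDominated}
    (hP : P ∈ Submodule.span ℂ (range fun k => powerElt (a k))) :
    ∃ G G' : powerDominated, ∃ g ∈ muntzSpan ℝ a, ∃ g' ∈ muntzSpan ℝ a, ∀ t, 0 < t →
      (G : ℝ → ℂ) t = (g t : ℂ) ∧ (G' : ℝ → ℂ) t = (g' t : ℂ) ∧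
      (P : ℝ → ℂ) t = g t + Complex.I * g' t := by
  induction hP using Submodule.span_induction with
  | mem P hP =>
    obtain ⟨k, rfl⟩ := hP
    refine ⟨powerElt (a k), 0, fun t => ((t ^ a k : ℝ) : ℝ), Submodule.subset_span ⟨k, rfl⟩, 0,
      Submodule.zero_mem _, fun t ht => ?_⟩
    have h0 : 0 < ((a k : ℝ) : ℂ).re := by simpa using ha_pos k
    simp [powerElt_apply h0, Complex.ofReal_cpow ht.le]
  | zero => exact ⟨0, 0, 0, Submodule.zero_mem _, 0, Submodule.zero_mem _, by simp⟩
  | add P Q _ _ hP hQ =>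
    obtain ⟨G₁, G₁', g₁, hg₁, g₁', hg₁', h₁⟩ := hP
    obtain ⟨G₂, G₂', g₂, hg₂, g₂', hg₂', h₂⟩ := hQ
    refine ⟨G₁ + G₂, G₁' + G₂', g₁ + g₂, Submodule.add_mem _ hg₁ hg₂, g₁' + g₂',
      Submodule.add_mem _ hg₁' hg₂', fun t ht => ?_⟩
    obtain ⟨e₁, e₁', f₁⟩ := h₁ t ht
    obtain ⟨e₂, e₂', f₂⟩ := h₂ t ht
    simp only [Submodule.coe_add, Pi.add_apply, e₁, e₁', f₁, e₂, e₂', f₂, Complex.ofReal_add]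
    refine ⟨trivial, trivial, ?_⟩
    ring
  | smul c P _ hP =>
    obtain ⟨G, G', g, hg, g', hg', h⟩ := hP
    refine ⟨(c.re : ℂ) • G - (c.im : ℂ) • G', (c.re : ℂ) • G' + (c.im : ℂ) • G,
      c.re • g - c.im • g', Submodule.sub_mem _ (Submodule.smul_mem _ _ hg)
        (Submodule.smul_mem _ _ hg'), c.re • g' + c.im • g,
      Submodule.add_mem _ (Submodule.smul_mem _ _ hg') (Submodule.smul_mem _ _ hg),
      fun t ht => ?_⟩
    obtain ⟨e, e', f⟩ := h t ht
    simp only [Submodule.coe_add, Submodule.coe_sub, Submodule.coe_smul, Pi.add_apply,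
      Pi.sub_apply, Pi.smul_apply, e, e', f, smul_eq_mul, Complex.ofReal_add, Complex.ofReal_sub,
      Complex.ofReal_mul]
    refine ⟨trivial, trivial, ?_⟩
    conv_lhs => rw [← Complex.re_add_im c]
    linear_combination (-(c.im : ℂ) * g' t) * Complex.I_mul_I.symm

/-- For a real target, taking the real part of a complex approximant cannot increase the pointwise
error, so by `hJ` it does not increase the norm. -/
theorem exists_muntzSpan_approx {X : Type*} [NormedAddCommGroup X] [NormedSpace ℂ X]
    [CompleteSpace X] (J : powerDominated →ₗ[ℂ] X)
    (hJ : ∀ u v : powerDominated,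
      (∀ t, 0 < t → ‖(u : ℝ → ℂ) t‖ ≤ ‖(v : ℝ → ℂ) t‖) → ‖J u‖ ≤ ‖J v‖)
    {a : ℕ → ℝ} (ha_pos : ∀ k, 0 < a k)
    (ha_sep : ∃ d : ℝ, 0 < d ∧ ∀ k, d < a (k + 1) - a k) {φ : ℝ → ℝ} (hφ : ∀ x, 0 ≤ φ x)
    {h : ℝ → ℝ} (hh : IsDivergentMinorant φ a h)
    (hφJ : ∀ z, 0 < z.re → ‖J (powerElt z)‖ ≤ φ z.re ^ z.re)
    {u : ℝ → ℝ} (hu : ContinuousOn u (Ioi 0)) {δ R : ℝ} (hδ : 0 < δ)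
    (hsupp : ∀ t, 0 < t → t ≤ δ ∨ R ≤ t → u t = 0) {ε : ℝ} (hε : 0 < ε) :
    ∃ g ∈ muntzSpan ℝ a, ∃ v : powerDominated,
      (∀ t, 0 < t → (v : ℝ → ℂ) t = ((u t - g t : ℝ) : ℂ)) ∧ ‖J v‖ < ε := by
  obtain ⟨K₀, hK₀⟩ := isCompact_Icc.exists_bound_of_continuousOn
    (hu.mono fun t ht => hδ.trans_le ht.1 : ContinuousOn u (Icc δ R))
  -- As u vanishes on (0, δ], a bound for |u| by Kδ is also a bound by Kt.
  set K := max K₀ 0 / δ with hK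
  have hK0 : 0 ≤ K := by positivity
  have hbd : ∀ t, 0 < t → ‖((u t : ℝ) : ℂ)‖ ≤ K * t := by
    intro t ht
    rw [Complex.norm_real]
    by_cases hts : t ≤ δ ∨ R ≤ t
    · rw [hsupp t ht hts, norm_zero]
      positivity
    · push Not at hts
      calc ‖u t‖ ≤ max K₀ 0 := (hK₀ t ⟨hts.1.le, hts.2.le⟩).trans (le_max_left _ _)
        _ = K * δ := by rw [hK]; field_simp
        _ ≤ K * t := by gcongr; exact hts.1.le
  set U : powerDominated := ⟨fun t => (u t : ℂ), mem_powerDominated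
    (Complex.continuous_ofReal.comp_continuousOn hu) one_pos one_pos hK0 fun t ht => by
      refine (hbd t ht).trans ?_
      rw [Real.rpow_one]
      gcongr
      linarith⟩ with hU
  have hmem := compactSupport_mem_of_powerElt_mem J hJ (Submodule.isClosed_topologicalClosure _)
    (fun z hz => powerElt_mem_closure_span J hJ ha_pos ha_sep hφ hh hφJ hz) U
    (L₀ := max (-Real.log δ) (Real.log (max R 1))) (K := K) (fun t ht hlog => by
      simp only [hU, Complex.ofReal_eq_zero]
      refine hsupp t ht ?_
      have hR1 : 0 < max R 1 := lt_max_of_lt_right one_pos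
      rcases le_total 0 (Real.log t) with h0 | h0
      · rw [abs_of_nonneg h0] at hlog
        right
        have := (Real.log_le_log_iff hR1 ht).1 ((le_max_right _ _).trans hlog)
        exact (le_max_left _ _).trans this
      · rw [abs_of_nonpos h0] at hlog
        left
        refine (Real.log_le_log_iff ht hδ).1 ?_
        linarith [le_max_left (-Real.log δ) (Real.log (max R 1))]) hbd
  rw [← SetLike.mem_coe, Submodule.topologicalClosure_coe] at hmem
  obtain ⟨y, hy, hUy⟩ := Metric.mem_closure_iff.1 hmem ε hε
  have hrange : (range fun k => J (powerElt (a k))) = J '' range fun k => powerElt (a k) := by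
    rw [← range_comp]
    rfl
  rw [hrange, ← Submodule.map_span, SetLike.mem_coe, Submodule.mem_map] at hy
  obtain ⟨P, hP, rfl⟩ := hy
  obtain ⟨G, _, g, hg, g', _, hGg⟩ := exists_real_parts ha_pos hP
  refine ⟨g, hg, U - G, fun t ht => ?_, ?_⟩
  · rw [Submodule.coe_sub, Pi.sub_apply, (hGg t ht).1, Complex.ofReal_sub]
  · rw [dist_eq_norm, ← map_sub] at hUy
    refine lt_of_le_of_lt (hJ _ _ fun t ht => ?_) hUy
    rw [Submodule.coe_sub, Submodule.coe_sub, Pi.sub_apply, Pi.sub_apply, (hGg t ht).1,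
      (hGg t ht).2.2, ← Complex.ofReal_sub, Complex.norm_real]
    refine le_trans (le_of_eq ?_) (Complex.abs_re_le_norm _)
    rw [Real.norm_eq_abs]
    simp [hU]

/-- A trapezoidal function equal to one on `[2 δ, R]` and to zero off `(δ, 2 R)`. -/
noncomputable def cutoff (δ R t : ℝ) : ℝ := max 0 (min 1 (min (t / δ - 1) (2 - t / R)))

theorem continuous_cutoff (δ R : ℝ) : Continuous (cutoff δ R) := by
  unfold cutoff
  fun_prop

theorem cutoff_nonneg (δ R t : ℝ) : 0 ≤ cutoff δ R t := le_max_left _ _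

theorem cutoff_le_one (δ R t : ℝ) : cutoff δ R t ≤ 1 := max_le zero_le_one (min_le_left _ _)

theorem cutoff_eq_zero {δ R t : ℝ} (hδ : 0 < δ) (hR : 0 < R) (ht : t ≤ δ ∨ 2 * R ≤ t) :
    cutoff δ R t = 0 := by
  refine max_eq_left ((min_le_right _ _).trans ?_)
  rcases ht with ht | ht
  · refine (min_le_left _ _).trans ?_
    rw [sub_nonpos, div_le_one hδ]
    exact ht
  · refine (min_le_right _ _).trans ?_
    rw [sub_nonpos, le_div_iff₀ hR]
    exact ht

theorem cutoff_eq_one {δ R t : ℝ} (hδ : 0 < δ) (hR : 0 < R) (h1 : 2 * δ ≤ t) (h2 : t ≤ R) :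
    cutoff δ R t = 1 := by
  have h3 : 1 ≤ t / δ - 1 := by
    have : 2 ≤ t / δ := by rwa [le_div_iff₀ hδ]
    linarith
  have h4 : 1 ≤ 2 - t / R := by
    have : t / R ≤ 1 := by rwa [div_le_one hR]
    linarith
  unfold cutoff
  rw [min_eq_left (le_min h3 h4), max_eq_right zero_le_one]

section Scalars

variable {𝕜 : Type*} [RCLike 𝕜]

theorem ofReal_mem_muntzSpan {a : ℕ → ℝ} {g : ℝ → ℝ} (hg : g ∈ muntzSpan ℝ a) :
    (fun t => (g t : 𝕜)) ∈ muntzSpan 𝕜 a := by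
  induction hg using Submodule.span_induction with
  | mem g hg =>
    obtain ⟨k, rfl⟩ := hg
    exact Submodule.subset_span ⟨k, rfl⟩
  | zero =>
    have : (fun t => (((0 : ℝ → ℝ) t : ℝ) : 𝕜)) = 0 := by ext; simp
    rw [this]
    exact Submodule.zero_mem _
  | add g₁ g₂ _ _ h₁ h₂ =>
    have : (fun t => (((g₁ + g₂) t : ℝ) : 𝕜)) = (fun t => (g₁ t : 𝕜)) + fun t => (g₂ t : 𝕜) := by
      ext; simp
    rw [this]
    exact Submodule.add_mem _ h₁ h₂
  | smul c g _ h =>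
    have : (fun t => (((c • g) t : ℝ) : 𝕜)) = (c : 𝕜) • fun t => (g t : 𝕜) := by
      ext; simp
    rw [this]
    exact Submodule.smul_mem _ _ h

theorem exists_mem_muntzSpan_norm_sub_le {a : ℕ → ℝ} {g₁ g₂ : ℝ → ℝ} (hg₁ : g₁ ∈ muntzSpan ℝ a)
    (hg₂ : g₂ ∈ muntzSpan ℝ a) (f : ℝ → 𝕜) :
    ∃ g ∈ muntzSpan 𝕜 a, ∀ t,
      ‖f t - g t‖ ≤ |RCLike.re (f t) - g₁ t| + |RCLike.im (f t) - g₂ t| := by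
  refine ⟨_, Submodule.add_mem _ (ofReal_mem_muntzSpan hg₁)
    (Submodule.smul_mem _ (RCLike.I : 𝕜) (ofReal_mem_muntzSpan hg₂)), fun t => ?_⟩
  have : f t - ((fun t => (g₁ t : 𝕜)) + (RCLike.I : 𝕜) • fun t => (g₂ t : 𝕜)) t =
      ((RCLike.re (f t) - g₁ t : ℝ) : 𝕜) + RCLike.I * ((RCLike.im (f t) - g₂ t : ℝ) : 𝕜) := by
    conv_lhs => rw [← RCLike.re_add_im (f t)]
    simp only [Pi.add_apply, Pi.smul_apply, smul_eq_mul, RCLike.ofReal_sub]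
    ring
  rw [this]
  refine (norm_add_le _ _).trans ?_
  rw [norm_mul, RCLike.norm_ofReal, RCLike.norm_ofReal]
  gcongr
  refine mul_le_of_le_one_left (abs_nonneg _) ?_
  by_cases hI : (RCLike.I : 𝕜) = 0
  · rw [hI, norm_zero]
    exact zero_le_one
  · exact (RCLike.norm_I_of_ne_zero hI).le

end Scalars

end Muntz

/-! ### Completeness in the weighted Lebesgue space. -/

namespace Muntz

section Lebesgue

variable {w : ℝ → ℝ} {p : ℝ}

theorem phiLp_nonneg (hw_pos : ∀ t : ℝ, 0 < t → 0 < w t) (p x : ℝ) : 0 ≤ phiLp w p x := by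
  refine Real.rpow_nonneg (setIntegral_nonneg measurableSet_Ioi fun t ht => ?_) _
  exact mul_nonneg (Real.rpow_nonneg (le_of_lt ht) _) (Real.rpow_nonneg (hw_pos t ht).le _)

theorem memLp_of_mem_powerDominated (hw_pos : ∀ t : ℝ, 0 < t → 0 < w t)
    (hw_cont : ContinuousOn w (Ioi 0))
    (hmem : ∀ x : ℝ, 0 < x →
      MemLp (fun t : ℝ => t ^ x * w t) (ENNReal.ofReal p) (volume.restrict (Ioi 0)))
    (u : powerDominated) :
    MemLp (fun t => (u : ℝ → ℂ) t * (w t : ℂ)) (ENNReal.ofReal p) (volume.restrict (Ioi 0)) := by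
  obtain ⟨hu, ε, C, hε, -, hC, hbd⟩ := u.2
  refine MemLp.mono (((hmem ε hε).add (hmem ε⁻¹ (inv_pos.2 hε))).const_mul C) ?_ ?_
  · exact ContinuousOn.aestronglyMeasurable
      (hu.mul (Complex.continuous_ofReal.comp_continuousOn hw_cont)) measurableSet_Ioi
  · filter_upwards [ae_restrict_mem measurableSet_Ioi] with t ht
    have hw := hw_pos t ht
    have h1 := Real.rpow_pos_of_pos ht ε
    have h2 := Real.rpow_pos_of_pos ht ε⁻¹
    rw [norm_mul, Complex.norm_real, Real.norm_of_nonneg hw.le, Pi.add_apply,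
      Real.norm_of_nonneg (by positivity), ← add_mul, ← mul_assoc]
    gcongr
    exact hbd t ht

/-- Multiplication by the weight, as a map into `L^p(0,∞)`. -/
noncomputable def toLpW (hw_pos : ∀ t : ℝ, 0 < t → 0 < w t) (hw_cont : ContinuousOn w (Ioi 0))
    (hmem : ∀ x : ℝ, 0 < x →
      MemLp (fun t : ℝ => t ^ x * w t) (ENNReal.ofReal p) (volume.restrict (Ioi 0))) :
    powerDominated →ₗ[ℂ] Lp ℂ (ENNReal.ofReal p) (volume.restrict (Ioi (0 : ℝ))) where
  toFun u := (memLp_of_mem_powerDominated hw_pos hw_cont hmem u).toLp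
  map_add' u v := by
    rw [← MemLp.toLp_add]
    refine MemLp.toLp_congr _ _ (Eventually.of_forall fun t => ?_)
    simp [add_mul]
  map_smul' c u := by
    rw [RingHom.id_apply, ← MemLp.toLp_const_smul]
    refine MemLp.toLp_congr _ _ (Eventually.of_forall fun t => ?_)
    simp [mul_assoc]

variable (hw_pos : ∀ t : ℝ, 0 < t → 0 < w t) (hw_cont : ContinuousOn w (Ioi 0))
  (hmem : ∀ x : ℝ, 0 < x →
    MemLp (fun t : ℝ => t ^ x * w t) (ENNReal.ofReal p) (volume.restrict (Ioi 0)))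

theorem norm_toLpW (u : powerDominated) :
    ‖toLpW hw_pos hw_cont hmem u‖ = (eLpNorm (fun t => (u : ℝ → ℂ) t * (w t : ℂ))
      (ENNReal.ofReal p) (volume.restrict (Ioi 0))).toReal :=
  Lp.norm_toLp _ (memLp_of_mem_powerDominated hw_pos hw_cont hmem u)

theorem norm_toLpW_mono (u v : powerDominated)
    (h : ∀ t, 0 < t → ‖(u : ℝ → ℂ) t‖ ≤ ‖(v : ℝ → ℂ) t‖) :
    ‖toLpW hw_pos hw_cont hmem u‖ ≤ ‖toLpW hw_pos hw_cont hmem v‖ := by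
  rw [norm_toLpW, norm_toLpW]
  refine ENNReal.toReal_mono
    (memLp_of_mem_powerDominated hw_pos hw_cont hmem v).eLpNorm_ne_top (eLpNorm_mono_ae ?_)
  filter_upwards [ae_restrict_mem measurableSet_Ioi] with t ht
  rw [norm_mul, norm_mul]
  gcongr
  exact h t ht

theorem norm_toLpW_powerElt (hp : 0 < p) {z : ℂ} (hz : 0 < z.re) :
    ‖toLpW hw_pos hw_cont hmem (powerElt z)‖ = phiLp w p z.re ^ z.re := by
  have hI : ∫ t in Ioi (0 : ℝ), ‖(powerElt z : ℝ → ℂ) t * (w t : ℂ)‖ ^ p =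
      ∫ t in Ioi (0 : ℝ), t ^ (p * z.re) * w t ^ p := by
    refine setIntegral_congr_fun measurableSet_Ioi fun t ht => ?_
    have ht0 : (0 : ℝ) < t := ht
    rw [norm_mul, powerElt_apply hz, norm_cpow ht, Complex.norm_real,
      Real.norm_of_nonneg (hw_pos t ht).le,
      Real.mul_rpow (Real.rpow_nonneg ht0.le _) (hw_pos t ht).le, ← Real.rpow_mul ht0.le, mul_comm p]
  have hI0 : 0 ≤ ∫ t in Ioi (0 : ℝ), t ^ (p * z.re) * w t ^ p :=
    setIntegral_nonneg measurableSet_Ioi fun t ht =>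
      mul_nonneg (Real.rpow_nonneg (le_of_lt ht) _) (Real.rpow_nonneg (hw_pos t ht).le _)
  rw [norm_toLpW, (memLp_of_mem_powerDominated hw_pos hw_cont hmem _).eLpNorm_eq_integral_rpow_norm
    (by simpa using hp) ENNReal.ofReal_ne_top, ENNReal.toReal_ofReal hp.le, hI,
    ENNReal.toReal_ofReal (Real.rpow_nonneg hI0 _), phiLp, ← Real.rpow_mul hI0]
  congr 1
  field_simp

theorem exists_real_approx_Lp {w : ℝ → ℝ} {p : ℝ} (hw_pos : ∀ t : ℝ, 0 < t → 0 < w t)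
    (hw_cont : ContinuousOn w (Ioi 0))
    (hmem : ∀ x : ℝ, 0 < x →
      MemLp (fun t : ℝ => t ^ x * w t) (ENNReal.ofReal p) (volume.restrict (Ioi 0))) {a : ℕ → ℝ} (ha_pos : ∀ k, 0 < a k)
    (ha_sep : ∃ d : ℝ, 0 < d ∧ ∀ k, d < a (k + 1) - a k) (hp : 1 ≤ p) {h : ℝ → ℝ}
    (hh : IsDivergentMinorant (phiLp w p) a h) {f : ℝ → ℝ}
    (hf : MemLp (fun t => f t * w t) (ENNReal.ofReal p) (volume.restrict (Ioi 0)))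
    {ε : ℝ≥0∞} (hε : ε ≠ 0) :
    ∃ g ∈ muntzSpan ℝ a, eLpNorm (fun t => (f t - g t) * w t) (ENNReal.ofReal p)
      (volume.restrict (Ioi 0)) ≤ ε := by
  have hfact : Fact (1 ≤ ENNReal.ofReal p) := ⟨by simpa using hp⟩
  set μ := volume.restrict (Ioi (0 : ℝ)) with hμ
  set q := ENNReal.ofReal p with hq
  have hε3 : ε / 3 ≠ 0 := ENNReal.div_ne_zero.2 ⟨hε, by norm_num⟩
  obtain ⟨h₀, hcs, hfh, hcont, hh₀⟩ :=
    hf.exists_hasCompactSupport_eLpNorm_sub_le ENNReal.ofReal_ne_top hε3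
  obtain ⟨B, hB⟩ := hcs.exists_bound_of_continuous hcont
  obtain ⟨R, hR0, hR⟩ : ∃ R : ℝ, 0 < R ∧ ∀ t, R ≤ t → h₀ t = 0 := by
    obtain ⟨R, hR⟩ := hcs.isCompact.isBounded.subset_closedBall 0
    refine ⟨max R 0 + 1, by positivity, fun t ht => ?_⟩
    by_contra hne
    have h1 := hR (subset_tsupport _ hne)
    rw [mem_closedBall_zero_iff, Real.norm_eq_abs] at h1
    linarith [le_abs_self t, le_max_left R 0]
  -- The support of `h₀` may reach 0, so it has to be cut off there. The constant `B` has small norm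
  -- on sets of measure at most η, and (0, 2δ) has length η.
  obtain ⟨η, hη0, hη⟩ := exists_eLpNorm_indicator_le (μ := μ) ENNReal.ofReal_ne_top B hε3 (p := q)
  set δ : ℝ := η / 2 with hδ
  have hδ0 : 0 < δ := by positivity
  set χ := cutoff δ R with hχ
  have hcut : eLpNorm (fun t => h₀ t - χ t * h₀ t) q μ ≤ ε / 3 := by
    refine le_trans (eLpNorm_mono_ae ?_) (hη (Ioo 0 (2 * δ)) ?_)
    · filter_upwards [ae_restrict_mem measurableSet_Ioi] with t ht
      by_cases ht2 : t < 2 * δ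
      · rw [indicator_of_mem (show t ∈ Ioo 0 (2 * δ) from ⟨ht, ht2⟩)]
        have h1 := cutoff_nonneg δ R t
        have h2 := cutoff_le_one δ R t
        have h3 : h₀ t - χ t * h₀ t = (1 - χ t) * h₀ t := by ring
        rw [h3, norm_mul, Real.norm_of_nonneg (by linarith)]
        calc (1 - χ t) * ‖h₀ t‖ ≤ 1 * B := by
              gcongr
              · linarith
              · exact hB t
          _ ≤ ‖B‖ := by rw [one_mul]; exact le_abs_self B
      · rcases le_total R t with htR | htR
        · simp [hR t htR]
        · rw [hχ, cutoff_eq_one hδ0 hR0 (not_lt.1 ht2) htR]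
          simp
    · refine (Measure.restrict_apply_le _ _).trans ?_
      rw [Real.volume_Ioo, sub_zero, hδ, mul_div_cancel₀ _ (two_ne_zero), ENNReal.ofReal_coe_nnreal]
  -- The target is f w, so the compactly supported approximant is divided by the weight.
  set u : ℝ → ℝ := fun t => χ t * h₀ t / w t with hu
  have huc : ContinuousOn u (Ioi 0) :=
    ((continuous_cutoff δ R).mul hcont).continuousOn.div hw_cont fun t ht => (hw_pos t ht).ne'
  obtain ⟨e, he0, he⟩ : ∃ e : ℝ, 0 < e ∧ ENNReal.ofReal e ≤ ε / 3 := by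
    rcases eq_or_ne (ε / 3) ⊤ with htop | htop
    · exact ⟨1, one_pos, by rw [htop]; exact le_top⟩
    · exact ⟨(ε / 3).toReal, ENNReal.toReal_pos hε3 htop, (ENNReal.ofReal_toReal htop).le⟩
  obtain ⟨g, hg, v, hv, hJv⟩ := exists_muntzSpan_approx (toLpW hw_pos hw_cont hmem)
    (norm_toLpW_mono hw_pos hw_cont hmem) ha_pos ha_sep (phiLp_nonneg hw_pos p) hh
    (fun z hz => (norm_toLpW_powerElt hw_pos hw_cont hmem (by linarith) hz).le) huc
    (δ := δ) (R := 2 * R) hδ0 (fun t ht hts => by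
      rw [hu]
      simp only
      rw [hχ, cutoff_eq_zero hδ0 hR0 hts, zero_mul, zero_div]) he0
  refine ⟨g, hg, ?_⟩
  have hvmem := memLp_of_mem_powerDominated hw_pos hw_cont hmem v
  have hvn : eLpNorm (fun t => (v : ℝ → ℂ) t * (w t : ℂ)) q μ ≤ ε / 3 := by
    refine le_trans ?_ he
    rw [norm_toLpW] at hJv
    rw [← ENNReal.ofReal_toReal hvmem.eLpNorm_ne_top]
    exact ENNReal.ofReal_le_ofReal hJv.le
  have hre := hvmem.re
  have hχm : AEStronglyMeasurable (fun t => h₀ t - χ t * h₀ t) μ :=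
    (hcont.sub ((continuous_cutoff δ R).mul hcont)).aestronglyMeasurable
  calc eLpNorm (fun t => (f t - g t) * w t) q μ
      = eLpNorm (((fun t => f t * w t) - h₀) + ((fun t => h₀ t - χ t * h₀ t) +
          fun t => RCLike.re ((v : ℝ → ℂ) t * (w t : ℂ)))) q μ := by
        refine eLpNorm_congr_ae ?_
        filter_upwards [ae_restrict_mem measurableSet_Ioi] with t ht
        have hwt := (hw_pos t ht).ne'
        simp only [Pi.add_apply, Pi.sub_apply, hv t ht, hu, ← Complex.ofReal_mul]
        simp only [RCLike.re_eq_complex_re, Complex.ofReal_re]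
        field_simp
        ring
    _ ≤ eLpNorm ((fun t => f t * w t) - h₀) q μ + (eLpNorm (fun t => h₀ t - χ t * h₀ t) q μ +
          eLpNorm (fun t => RCLike.re ((v : ℝ → ℂ) t * (w t : ℂ))) q μ) := by
        refine (eLpNorm_add_le (hf.1.sub hh₀.1) (hχm.add hre.1) hfact.1).trans ?_
        gcongr
        exact eLpNorm_add_le hχm hre.1 hfact.1
    _ ≤ ε / 3 + (ε / 3 + ε / 3) := by
        gcongr
        refine le_trans (eLpNorm_mono_ae (Eventually.of_forall fun t => ?_)) hvn
        exact RCLike.norm_re_le_norm _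
    _ = ε := by rw [← add_assoc, ENNReal.add_thirds]

theorem completeInLpW {𝕜 : Type*} [RCLike 𝕜] {w : ℝ → ℝ} {p : ℝ}
    (hw_pos : ∀ t : ℝ, 0 < t → 0 < w t) (hw_cont : ContinuousOn w (Ioi 0))
    (hmem : ∀ x : ℝ, 0 < x →
      MemLp (fun t : ℝ => t ^ x * w t) (ENNReal.ofReal p) (volume.restrict (Ioi 0)))
    {a : ℕ → ℝ} (ha_pos : ∀ k, 0 < a k)
    (ha_sep : ∃ d : ℝ, 0 < d ∧ ∀ k, d < a (k + 1) - a k) (hp : 1 ≤ p) {h : ℝ → ℝ}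
    (hh : IsDivergentMinorant (phiLp w p) a h) : CompleteInLpW 𝕜 w p a := by
  have hp1 : 1 ≤ ENNReal.ofReal p := by simpa using hp
  have hsub : ∀ g ∈ muntzSpan 𝕜 a, g ∈ LpW 𝕜 w p := by
    intro g hg
    induction hg using Submodule.span_induction with
    | mem g hg =>
      obtain ⟨k, rfl⟩ := hg
      have := (hmem (a k) (ha_pos k)).ofReal (K := 𝕜)
      simpa [LpW] using this
    | zero => simp [LpW]
    | add g₁ g₂ _ _ h₁ h₂ =>
      have := MemLp.add h₁ h₂
      refine this.ae_eq (Eventually.of_forall fun t => ?_)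
      simp [add_mul]
    | smul c g _ hg =>
      have := MemLp.const_mul hg c
      refine this.ae_eq (Eventually.of_forall fun t => ?_)
      simp [mul_assoc]
  refine ⟨hsub, fun f hf ε hε => ?_⟩
  -- Only real and imaginary parts are added; thirds leave room for the strict inequality.
  have hε3 : ENNReal.ofReal (ε / 3) ≠ 0 := by simpa using hε
  have hfre : MemLp (fun t => RCLike.re (f t) * w t) (ENNReal.ofReal p)
      (volume.restrict (Ioi 0)) := by
    simpa using MemLp.re hf
  have hfim : MemLp (fun t => RCLike.im (f t) * w t) (ENNReal.ofReal p)
      (volume.restrict (Ioi 0)) := by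
    simpa using MemLp.im hf
  obtain ⟨g₁, hg₁, hn₁⟩ := exists_real_approx_Lp hw_pos hw_cont hmem ha_pos ha_sep hp hh hfre hε3
  obtain ⟨g₂, hg₂, hn₂⟩ := exists_real_approx_Lp hw_pos hw_cont hmem ha_pos ha_sep hp hh hfim hε3
  obtain ⟨g, hg, hle⟩ := exists_mem_muntzSpan_norm_sub_le hg₁ hg₂ f
  have hmeas : ∀ g ∈ muntzSpan ℝ a, AEStronglyMeasurable (fun t => g t * w t)
      (volume.restrict (Ioi 0)) := by
    intro g hg
    induction hg using Submodule.span_induction with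
    | mem g hg =>
      obtain ⟨k, rfl⟩ := hg
      exact (hmem (a k) (ha_pos k)).1
    | zero => simpa using aestronglyMeasurable_const
    | add g₁ g₂ _ _ h₁ h₂ =>
      simp only [Pi.add_apply, add_mul]
      exact h₁.add h₂
    | smul c g _ hg => simpa [mul_assoc] using hg.const_mul c
  refine ⟨g, hg, ?_⟩
  have hm₁ : AEStronglyMeasurable (fun t => |(RCLike.re (f t) - g₁ t) * w t|)
      (volume.restrict (Ioi 0)) := by
    simp only [sub_mul]
    exact (hfre.1.sub (hmeas g₁ hg₁)).norm
  have hm₂ : AEStronglyMeasurable (fun t => |(RCLike.im (f t) - g₂ t) * w t|)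
      (volume.restrict (Ioi 0)) := by
    simp only [sub_mul]
    exact (hfim.1.sub (hmeas g₂ hg₂)).norm
  calc normLpW w p (f - g)
      ≤ eLpNorm ((fun t => |(RCLike.re (f t) - g₁ t) * w t|) +
          fun t => |(RCLike.im (f t) - g₂ t) * w t|) (ENNReal.ofReal p)
          (volume.restrict (Ioi 0)) := by
        refine eLpNorm_mono_ae (Eventually.of_forall fun t => ?_)
        rw [Pi.add_apply, Real.norm_of_nonneg (by positivity), norm_mul, RCLike.norm_ofReal,
          abs_mul, abs_mul, ← add_mul]
        gcongr
        exact hle t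
    _ ≤ eLpNorm (fun t => |(RCLike.re (f t) - g₁ t) * w t|) (ENNReal.ofReal p)
          (volume.restrict (Ioi 0)) + eLpNorm (fun t => |(RCLike.im (f t) - g₂ t) * w t|)
          (ENNReal.ofReal p) (volume.restrict (Ioi 0)) := eLpNorm_add_le hm₁ hm₂ hp1
    _ ≤ ENNReal.ofReal (ε / 3) + ENNReal.ofReal (ε / 3) := by
        refine add_le_add ?_ ?_
        · exact (eLpNorm_norm (fun t => (RCLike.re (f t) - g₁ t) * w t)).trans_le hn₁
        · exact (eLpNorm_norm (fun t => (RCLike.im (f t) - g₂ t) * w t)).trans_le hn₂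
    _ < ENNReal.ofReal ε := by
        rw [← ENNReal.ofReal_add (by positivity) (by positivity)]
        exact (ENNReal.ofReal_lt_ofReal_iff hε).2 (by linarith)

end Lebesgue

end Muntz

/-! ### Completeness in the weighted uniform space. -/

namespace Muntz

section Uniform

theorem phiC_nonneg {w : ℝ → ℝ} (hw_pos : ∀ t : ℝ, 0 < t → 0 < w t) (x : ℝ) : 0 ≤ phiC w x := by
  refine Real.rpow_nonneg (Real.iSup_nonneg fun t => ?_) _
  exact mul_nonneg (Real.rpow_nonneg (le_of_lt t.2) _) (hw_pos t t.2).le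

/-- A function continuous on `(0,∞)` tending to zero at both ends is small off a compact set. -/
theorem exists_small_off_Icc {f : ℝ → ℝ} (h0 : Tendsto f (𝓝[>] 0) (𝓝 0))
    (hinf : Tendsto f atTop (𝓝 0)) {ε : ℝ} (hε : 0 < ε) :
    ∃ δ R : ℝ, 0 < δ ∧ 0 < R ∧ ∀ t, 0 < t → t < 2 * δ ∨ R < t → |f t| < ε := by
  have h1 : ∀ᶠ t in 𝓝[>] 0, |f t| < ε := by
    simpa using h0.eventually (Metric.ball_mem_nhds 0 hε)
  have h2 : ∀ᶠ t in atTop, |f t| < ε := by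
    simpa using hinf.eventually (Metric.ball_mem_nhds 0 hε)
  obtain ⟨δ, hδ, hδ'⟩ := (mem_nhdsGT_iff_exists_Ioo_subset' (zero_lt_one' ℝ)).1 h1
  obtain ⟨R, hR⟩ := eventually_atTop.1 h2
  have hδ0 : (0 : ℝ) < δ := hδ
  -- Halving matches the cutoff, which equals one only from twice its first parameter on.
  refine ⟨δ / 2, max R 1, by positivity, by positivity, fun t ht hts => ?_⟩
  rcases hts with h | h
  · exact hδ' ⟨ht, by linarith⟩
  · exact hR t ((le_max_left _ _).trans h.le)

theorem exists_bound_of_tendsto {f : ℝ → ℝ} (hf : ContinuousOn f (Ioi 0))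
    (h0 : Tendsto f (𝓝[>] 0) (𝓝 0)) (hinf : Tendsto f atTop (𝓝 0)) :
    ∃ C, ∀ t, 0 < t → |f t| ≤ C := by
  obtain ⟨δ, R, hδ, -, h⟩ := exists_small_off_Icc h0 hinf one_pos
  obtain ⟨C, hC⟩ := isCompact_Icc.exists_bound_of_continuousOn
    (hf.mono fun t ht => lt_of_lt_of_le (by positivity) ht.1 : ContinuousOn f (Icc (2 * δ) R))
  refine ⟨max C 1, fun t ht => ?_⟩
  by_cases hts : t < 2 * δ ∨ R < t
  · exact (h t ht hts).le.trans (le_max_right _ _)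
  · push Not at hts
    exact (hC t hts).trans (le_max_left _ _)

variable {w : ℝ → ℝ}

theorem bddAbove_range_rpow_mul (hw_cont : ContinuousOn w (Ioi 0))
    (hlim : ∀ x : ℝ, 0 < x →
      Tendsto (fun t : ℝ => t ^ x * w t) (𝓝[>] 0) (𝓝 0) ∧
      Tendsto (fun t : ℝ => t ^ x * w t) atTop (𝓝 0)) {x : ℝ} (hx : 0 < x) :
    BddAbove (range fun t : Ioi (0 : ℝ) => (t : ℝ) ^ x * w t) := by
  obtain ⟨C, hC⟩ := exists_bound_of_tendsto (((Real.continuous_rpow_const hx.le).continuousOn).mul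
    hw_cont) (hlim x hx).1 (hlim x hx).2
  refine ⟨C, ?_⟩
  rintro _ ⟨t, rfl⟩
  exact (le_abs_self _).trans (hC t t.2)

theorem exists_bound_of_mem_powerDominated (hw_pos : ∀ t : ℝ, 0 < t → 0 < w t)
    (hw_cont : ContinuousOn w (Ioi 0))
    (hlim : ∀ x : ℝ, 0 < x →
      Tendsto (fun t : ℝ => t ^ x * w t) (𝓝[>] 0) (𝓝 0) ∧
      Tendsto (fun t : ℝ => t ^ x * w t) atTop (𝓝 0)) (u : powerDominated) :
    ∃ C, ∀ t : Ioi (0 : ℝ), ‖(u : ℝ → ℂ) t * (w t : ℂ)‖ ≤ C := by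
  obtain ⟨hu, ε, C, hε, -, hC, hbd⟩ := u.2
  obtain ⟨C₁, hC₁⟩ := bddAbove_range_rpow_mul hw_cont hlim hε
  obtain ⟨C₂, hC₂⟩ := bddAbove_range_rpow_mul hw_cont hlim (inv_pos.2 hε)
  refine ⟨C * (C₁ + C₂), fun t => ?_⟩
  have hw := hw_pos t t.2
  rw [norm_mul, Complex.norm_real, Real.norm_of_nonneg hw.le]
  calc ‖(u : ℝ → ℂ) t‖ * w t ≤ C * ((t : ℝ) ^ ε + (t : ℝ) ^ ε⁻¹) * w t := by
        gcongr; exact hbd t t.2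
    _ = C * ((t : ℝ) ^ ε * w t + (t : ℝ) ^ ε⁻¹ * w t) := by ring
    _ ≤ _ := by
        gcongr
        · exact hC₁ ⟨t, rfl⟩
        · exact hC₂ ⟨t, rfl⟩

/-- Multiplication by the weight, as a map into the bounded continuous functions on `(0,∞)`. -/
noncomputable def toCW (hw_pos : ∀ t : ℝ, 0 < t → 0 < w t) (hw_cont : ContinuousOn w (Ioi 0))
    (hlim : ∀ x : ℝ, 0 < x →
      Tendsto (fun t : ℝ => t ^ x * w t) (𝓝[>] 0) (𝓝 0) ∧
      Tendsto (fun t : ℝ => t ^ x * w t) atTop (𝓝 0)) :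
    powerDominated →ₗ[ℂ] BoundedContinuousFunction (Ioi (0 : ℝ)) ℂ where
  toFun u := BoundedContinuousFunction.ofNormedAddCommGroup
    (fun t : Ioi (0 : ℝ) => (u : ℝ → ℂ) t * (w t : ℂ))
    (continuousOn_iff_continuous_domRestrict.1
      (u.2.1.mul (Complex.continuous_ofReal.comp_continuousOn hw_cont)))
    _ (exists_bound_of_mem_powerDominated hw_pos hw_cont hlim u).choose_spec
  map_add' u v := by
    ext t
    exact add_mul _ _ _
  map_smul' c u := by
    ext t
    exact mul_assoc _ _ _

variable (hw_pos : ∀ t : ℝ, 0 < t → 0 < w t) (hw_cont : ContinuousOn w (Ioi 0))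
  (hlim : ∀ x : ℝ, 0 < x →
    Tendsto (fun t : ℝ => t ^ x * w t) (𝓝[>] 0) (𝓝 0) ∧
    Tendsto (fun t : ℝ => t ^ x * w t) atTop (𝓝 0))

theorem toCW_apply (u : powerDominated) (t : Ioi (0 : ℝ)) :
    toCW hw_pos hw_cont hlim u t = (u : ℝ → ℂ) t * (w t : ℂ) := rfl

theorem norm_toCW_mono (u v : powerDominated)
    (h : ∀ t, 0 < t → ‖(u : ℝ → ℂ) t‖ ≤ ‖(v : ℝ → ℂ) t‖) :
    ‖toCW hw_pos hw_cont hlim u‖ ≤ ‖toCW hw_pos hw_cont hlim v‖ := by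
  rw [BoundedContinuousFunction.norm_le (norm_nonneg _)]
  intro t
  refine le_trans ?_ (BoundedContinuousFunction.norm_coe_le_norm _ t)
  rw [toCW_apply, toCW_apply, norm_mul, norm_mul]
  gcongr
  exact h t t.2

theorem norm_toCW_powerElt {z : ℂ} (hz : 0 < z.re) :
    ‖toCW hw_pos hw_cont hlim (powerElt z)‖ ≤ phiC w z.re ^ z.re := by
  have h0 : 0 ≤ ⨆ t : Ioi (0 : ℝ), (t : ℝ) ^ z.re * w t := Real.iSup_nonneg fun t =>
    mul_nonneg (Real.rpow_nonneg (le_of_lt t.2) _) (hw_pos t t.2).le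
  rw [phiC, ← Real.rpow_mul h0, one_div_mul_cancel hz.ne', Real.rpow_one,
    BoundedContinuousFunction.norm_le h0]
  intro t
  rw [toCW_apply, norm_mul, powerElt_apply hz, norm_cpow t.2, Complex.norm_real,
    Real.norm_of_nonneg (hw_pos t t.2).le]
  exact le_ciSup (bddAbove_range_rpow_mul hw_cont hlim hz) t

theorem exists_real_approx_CW {w : ℝ → ℝ} (hw_pos : ∀ t : ℝ, 0 < t → 0 < w t)
    (hw_cont : ContinuousOn w (Ioi 0))
    (hlim : ∀ x : ℝ, 0 < x →
      Tendsto (fun t : ℝ => t ^ x * w t) (𝓝[>] 0) (𝓝 0) ∧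
      Tendsto (fun t : ℝ => t ^ x * w t) atTop (𝓝 0)) {a : ℕ → ℝ} (ha_pos : ∀ k, 0 < a k)
    (ha_sep : ∃ d : ℝ, 0 < d ∧ ∀ k, d < a (k + 1) - a k) {h : ℝ → ℝ}
    (hh : IsDivergentMinorant (phiC w) a h) {f : ℝ → ℝ} (hf : ContinuousOn f (Ioi 0))
    (hf0 : Tendsto (fun t => f t * w t) (𝓝[>] 0) (𝓝 0))
    (hfinf : Tendsto (fun t => f t * w t) atTop (𝓝 0)) {ε : ℝ} (hε : 0 < ε) :
    ∃ g ∈ muntzSpan ℝ a, ∀ t, 0 < t → |f t - g t| * w t ≤ ε := by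
  obtain ⟨δ, R, hδ, hR, hsmall⟩ := exists_small_off_Icc hf0 hfinf (half_pos hε)
  obtain ⟨g, hg, v, hv, hJv⟩ := exists_muntzSpan_approx (toCW hw_pos hw_cont hlim)
    (norm_toCW_mono hw_pos hw_cont hlim) ha_pos ha_sep (phiC_nonneg hw_pos) hh
    (fun z hz => norm_toCW_powerElt hw_pos hw_cont hlim hz)
    (u := fun t => cutoff δ R t * f t) ((continuous_cutoff δ R).continuousOn.mul hf)
    (δ := δ) (R := 2 * R) hδ (fun t _ hts => by rw [cutoff_eq_zero hδ hR hts, zero_mul])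
    (half_pos hε)
  refine ⟨g, hg, fun t ht => ?_⟩
  have hw := hw_pos t ht
  have h1 : |cutoff δ R t * f t - g t| * w t ≤ ε / 2 := by
    have := (BoundedContinuousFunction.norm_coe_le_norm (toCW hw_pos hw_cont hlim v)
      ⟨t, ht⟩).trans hJv.le
    rwa [toCW_apply, norm_mul, hv t ht, Complex.norm_real, Complex.norm_real,
      Real.norm_of_nonneg hw.le] at this
  -- The cutoff takes values in [0,1] and differs from one only where |f w| is already below ε/2.
  have h2 : |f t - cutoff δ R t * f t| * w t ≤ ε / 2 := by
    have e : f t - cutoff δ R t * f t = (1 - cutoff δ R t) * f t := by ring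
    by_cases hts : t < 2 * δ ∨ R < t
    · have h3 := hsmall t ht hts
      rw [abs_mul, abs_of_pos hw] at h3
      have h4 := cutoff_nonneg δ R t
      have h5 := cutoff_le_one δ R t
      rw [e, abs_mul, abs_of_nonneg (by linarith), mul_assoc]
      have h6 : 0 ≤ |f t| * w t := by positivity
      nlinarith
    · push Not at hts
      rw [e, cutoff_eq_one hδ hR hts.1 hts.2]
      simpa using (half_pos hε).le
  calc |f t - g t| * w t
      ≤ (|f t - cutoff δ R t * f t| + |cutoff δ R t * f t - g t|) * w t := by
        gcongr
        exact abs_sub_le _ _ _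
    _ ≤ ε := by rw [add_mul]; linarith

theorem completeInCW {𝕜 : Type*} [RCLike 𝕜] {w : ℝ → ℝ}
    (hw_pos : ∀ t : ℝ, 0 < t → 0 < w t) (hw_cont : ContinuousOn w (Ioi 0))
    (hlim : ∀ x : ℝ, 0 < x →
      Tendsto (fun t : ℝ => t ^ x * w t) (𝓝[>] 0) (𝓝 0) ∧
      Tendsto (fun t : ℝ => t ^ x * w t) atTop (𝓝 0))
    {a : ℕ → ℝ} (ha_pos : ∀ k, 0 < a k)
    (ha_sep : ∃ d : ℝ, 0 < d ∧ ∀ k, d < a (k + 1) - a k) {h : ℝ → ℝ}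
    (hh : IsDivergentMinorant (phiC w) a h) : CompleteInCW 𝕜 w a := by
  have hsub : ∀ g ∈ muntzSpan 𝕜 a, g ∈ CW 𝕜 w := by
    intro g hg
    induction hg using Submodule.span_induction with
    | mem g hg =>
      obtain ⟨k, rfl⟩ := hg
      have key : ∀ l : Filter ℝ, Tendsto (fun t : ℝ => t ^ a k * w t) l (𝓝 0) →
          Tendsto (fun t : ℝ => ((t ^ a k : ℝ) : 𝕜) * (w t : 𝕜)) l (𝓝 0) := by
        intro l hl
        have := (RCLike.continuous_ofReal (K := 𝕜)).tendsto 0 |>.comp hl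
        simpa [Function.comp_def] using this
      refine ⟨?_, key _ (hlim _ (ha_pos k)).1, key _ (hlim _ (ha_pos k)).2⟩
      exact (RCLike.continuous_ofReal.comp (Real.continuous_rpow_const (ha_pos k).le)).continuousOn
    | zero => exact ⟨continuousOn_const, by simp, by simp⟩
    | add g₁ g₂ _ _ h₁ h₂ =>
      refine ⟨h₁.1.add h₂.1, ?_, ?_⟩
      · simpa [add_mul] using h₁.2.1.add h₂.2.1
      · simpa [add_mul] using h₁.2.2.add h₂.2.2
    | smul c g _ hg =>
      refine ⟨hg.1.const_smul c, ?_, ?_⟩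
      · simpa [mul_assoc] using hg.2.1.const_mul c
      · simpa [mul_assoc] using hg.2.2.const_mul c
  refine ⟨hsub, fun f hf ε hε => ?_⟩
  have hre : ∀ l : Filter ℝ, Tendsto (fun t => f t * (w t : 𝕜)) l (𝓝 0) →
      Tendsto (fun t => RCLike.re (f t) * w t) l (𝓝 0) := by
    intro l hl
    have := (RCLike.continuous_re (K := 𝕜)).tendsto 0 |>.comp hl
    simpa [Function.comp_def] using this
  have him : ∀ l : Filter ℝ, Tendsto (fun t => f t * (w t : 𝕜)) l (𝓝 0) →
      Tendsto (fun t => RCLike.im (f t) * w t) l (𝓝 0) := by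
    intro l hl
    have := (RCLike.continuous_im (K := 𝕜)).tendsto 0 |>.comp hl
    simpa [Function.comp_def] using this
  have hε3 : 0 < ε / 3 := by positivity
  obtain ⟨g₁, hg₁, hn₁⟩ := exists_real_approx_CW hw_pos hw_cont hlim ha_pos ha_sep hh
    (RCLike.continuous_re.comp_continuousOn hf.1) (hre _ hf.2.1) (hre _ hf.2.2) hε3
  obtain ⟨g₂, hg₂, hn₂⟩ := exists_real_approx_CW hw_pos hw_cont hlim ha_pos ha_sep hh
    (RCLike.continuous_im.comp_continuousOn hf.1) (him _ hf.2.1) (him _ hf.2.2) hε3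
  obtain ⟨g, hg, hle⟩ := exists_mem_muntzSpan_norm_sub_le hg₁ hg₂ f
  refine ⟨g, hg, ?_⟩
  refine lt_of_le_of_lt (b := ENNReal.ofReal (2 * (ε / 3))) (iSup_le fun t => ?_)
    ((ENNReal.ofReal_lt_ofReal_iff hε).2 (by linarith))
  have hw := hw_pos t t.2
  rw [← ofReal_norm]
  refine ENNReal.ofReal_le_ofReal ?_
  rw [norm_mul, RCLike.norm_ofReal, abs_of_pos hw, Pi.sub_apply]
  calc ‖f t - g t‖ * w t
      ≤ (|RCLike.re (f t) - g₁ t| + |RCLike.im (f t) - g₂ t|) * w t := by gcongr; exact hle t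
    _ ≤ 2 * (ε / 3) := by
      rw [add_mul]
      have h1 := hn₁ t t.2
      have h2 := hn₂ t t.2
      simp only [Function.comp_apply] at h1 h2
      linarith

end Uniform

end Muntz

theorem theorem3 {𝕜 : Type*} [RCLike 𝕜] (w : ℝ → ℝ)
    (hw_pos : ∀ t : ℝ, 0 < t → 0 < w t) (hw_cont : ContinuousOn w (Ioi 0))
    (a : ℕ → ℝ) (ha_pos : ∀ k, 0 < a k)
    (ha_sep : ∃ d : ℝ, 0 < d ∧ ∀ k, d < a (k + 1) - a k) :
    (∀ p : ℝ, 1 ≤ p →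
      (∀ x : ℝ, 0 < x →
        MemLp (fun t : ℝ => t ^ x * w t) (ENNReal.ofReal p) (volume.restrict (Ioi 0))) →
      (∃ h : ℝ → ℝ, Muntz.IsDivergentMinorant (Muntz.phiLp w p) a h) →
      Muntz.CompleteInLpW 𝕜 w p a) ∧
    ((∀ x : ℝ, 0 < x →
        Tendsto (fun t : ℝ => t ^ x * w t) (𝓝[>] 0) (𝓝 0) ∧
        Tendsto (fun t : ℝ => t ^ x * w t) atTop (𝓝 0)) →
      (∃ h : ℝ → ℝ, Muntz.IsDivergentMinorant (Muntz.phiC w) a h) →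
      Muntz.CompleteInCW 𝕜 w a) :=
  ⟨fun _ hp hmem ⟨_, hh⟩ => Muntz.completeInLpW hw_pos hw_cont hmem ha_pos ha_sep hp hh,
    fun hlim ⟨_, hh⟩ => Muntz.completeInCW hw_pos hw_cont hlim ha_pos ha_sep hh⟩
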